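/- **Fractional Morawetz estimate from infinity.** Work on $\mathbb{R}^{1+3}$ with coordinates $(t,x)$, and write $r=|x|$, $\omega=x/|x|$, $\partial_r=\omega^i\partial_i$, $\langle q\rangle=(1+q^2)^{1/2}$, $\Box=-\partial_t^2+\Delta$, and let $\nabla\!\!\!\!/\,\psi=\nabla\psi-(\partial_r\psi)\,\omega$ denote the angular gradient. For $s\ge 1$ and a real-valued function $\phi$ put $$\|\phi(t)\|_{1,+,s-1}^2=\int_{\mathbb{R}^3}\Big[\langle t+r\rangle^{2s}\big(|(\partial_t+\partial_r)(r\phi)|^2+|\nabla\!\!\!\!/\,(r\phi)|^2\big)+\langle t-r\rangle^{2s}\Big(|(\partial_t-\partial_r)(r\phi)|^2+\phi^2+\frac{(r\phi)^2}{\langle t-r\rangle^2}\Big)\Big]\frac{dx}{r^2}$$ and, for $R\in\mathbb{R}$, let $$F^s_R(t_1,t_2)=\int_{\{t\in[t_1,t_2]:\,R-(t_2-t)>0\}}\int_{\mathbb{S}^2}\Big[\langle t+r\rangle^{2s}|(\partial_t+\partial_r)(r\phi)|^2+\langle t-r\rangle^{2s}|\nabla\!\!\!\!/\,(r\phi)|^2\Big]_{r=R-(t_2-t)}dS(\omega)\,dt$$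 be the flux through the outgoing cone $t-|x|=t_2-R$, where $dS(\omega)$ is the area measure of the unit sphere. All these quantities take values in $[0,\infty]$. For every $s\ge 1$ there is a constant $C$, depending only on $s$, such that the following holds for all $0\le t_1\le t_2$ and every real-valued $\phi$ that is $C^2$ in a neighbourhood of every point of $[t_1,t_2]\times\mathbb{R}^3$. (i) If $\lim_{r\to\infty}\sup_{\omega\in\mathbb{S}^2}r^{s+1/2}|\phi(t_1,r\omega)|=0$, then $$\|\phi(t_1)\|_{1,+,s-1}+\sup_{R}F^s_R(t_1,t_2)^{1/2}\le C\Big(\|\phi(t_2)\|_{1,+,s-1}+\int_{t_1}^{t_2}\|\langle t+r\rangle^s\,\Box\phi(t,\cdot)\|_{L^2(\mathbb{R}^3)}\,dt\Big).$$ (ii) One has $$\sum_{|I|\le 1}\|\langle t_1-r\rangle^{s-1}(Z^I\phi)(t_1,\cdot)\|_{L^2(\mathbb{R}^3)}\le C\,\|\phi(t_1)\|_{1,+,s-1},$$ where $Z^I\phi$, $|I|\le 1$, runs through $\phi$ itself and the derivatives of $\phi$ along the translations $\partial_t,\partial_i$, the rotations $x^i\partial_j-x^j\partial_i$ ($i<j$),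 the boosts $x^i\partial_t+t\partial_i$ and the scaling field $t\partial_t+x^i\partial_i$. -/

import Mathlib

open MeasureTheory Set Filter Topology
open scoped ENNReal NNReal

noncomputable section

namespace Morawetz

/-- Euclidean space `ℝ³`; `r = ‖x‖` is the Euclidean radius. -/
abbrev E3 : Type := EuclideanSpace ℝ (Fin 3)

/-- The Japanese bracket `⟨q⟩ = (1 + q²)^{1/2}`. -/
def jb (q : ℝ) : ℝ := Real.sqrt (1 + q ^ 2)

/-- The time derivative `∂_t ψ (t, x)`. -/
def dt (ψ : ℝ → E3 → ℝ) (t : ℝ) (x : E3) : ℝ := deriv (fun τ => ψ τ x) t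

/-- The Cartesian derivative `∂_i ψ (t, x)`. -/
def dx (i : Fin 3) (ψ : ℝ → E3 → ℝ) (t : ℝ) (x : E3) : ℝ :=
  fderiv ℝ (ψ t) x (EuclideanSpace.single i 1)

/-- The radial derivative `∂_r ψ = ω · ∇ψ`, where `ω = x / |x|`. -/
def dr (ψ : ℝ → E3 → ℝ) (t : ℝ) (x : E3) : ℝ :=
  fderiv ℝ (ψ t) x (‖x‖⁻¹ • x)

/-- The outgoing null derivative `L ψ = (∂_t + ∂_r) ψ`. -/
def dL (ψ : ℝ → E3 → ℝ) (t : ℝ) (x : E3) : ℝ := dt ψ t x + dr ψ t x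

/-- The incoming null derivative `(∂_t - ∂_r) ψ`. -/
def dLbar (ψ : ℝ → E3 → ℝ) (t : ℝ) (x : E3) : ℝ := dt ψ t x - dr ψ t x

/-- The angular gradient: the part of the spatial gradient tangential to the sphere
`|x| = r`, that is `∇ψ - (∂_r ψ) ω`. -/
def angGrad (ψ : ℝ → E3 → ℝ) (t : ℝ) (x : E3) : E3 :=
  gradient (ψ t) x - dr ψ t x • (‖x‖⁻¹ • x)

/-- The wave operator `□ = -∂_t² + ∑ ∂_i²` of the Minkowski metric `diag(-1, 1, 1, 1)`. -/
def box (φ : ℝ → E3 → ℝ) (t : ℝ) (x : E3) : ℝ :=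
  - dt (dt φ) t x + ∑ i : Fin 3, dx i (dx i φ) t x

/-- The function `r φ`. -/
def rMul (φ : ℝ → E3 → ℝ) (t : ℝ) (x : E3) : ℝ := ‖x‖ * φ t x

/-- The norm `‖φ(t)‖_{1,+,s-1}`, with values in `[0, ∞]`. -/
def normPlus (s : ℝ) (φ : ℝ → E3 → ℝ) (t : ℝ) : ℝ≥0∞ :=
  (∫⁻ x : E3, ENNReal.ofReal
    ((jb (t + ‖x‖) ^ (2 * s) * (dL (rMul φ) t x ^ 2 + ‖angGrad (rMul φ) t x‖ ^ 2)
      + jb (t - ‖x‖) ^ (2 * s) * (dLbar (rMul φ) t x ^ 2 + φ t x ^ 2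
          + (‖x‖ * φ t x) ^ 2 / jb (t - ‖x‖) ^ 2))
      / ‖x‖ ^ 2)) ^ (1 / 2 : ℝ)

/-- The density of the conformal flux through an outgoing cone. -/
def fluxDensity (s : ℝ) (φ : ℝ → E3 → ℝ) (t : ℝ) (x : E3) : ℝ :=
  jb (t + ‖x‖) ^ (2 * s) * dL (rMul φ) t x ^ 2
    + jb (t - ‖x‖) ^ (2 * s) * ‖angGrad (rMul φ) t x‖ ^ 2

/-- The flux `F_R^s(t₁, t₂)` through the outgoing cone `t - |x| = t₂ - R`, `t₁ ≤ t ≤ t₂`.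
At time `t` the cone is the sphere of radius `R - (t₂ - t)`, present when this is positive,
and the integral is over the angle `ω` in the unit sphere with its surface measure. -/
def flux (s : ℝ) (φ : ℝ → E3 → ℝ) (R t₁ t₂ : ℝ) : ℝ≥0∞ :=
  ∫⁻ t in {t : ℝ | t ∈ Icc t₁ t₂ ∧ 0 < R - (t₂ - t)},
    ∫⁻ ω : Metric.sphere (0 : E3) 1,
      ENNReal.ofReal (fluxDensity s φ t ((R - (t₂ - t)) • (ω : E3)))
      ∂((volume : Measure E3).toSphere)

/-- The rotation `x^i ∂_j - x^j ∂_i`. -/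
def rot (i j : Fin 3) (φ : ℝ → E3 → ℝ) (t : ℝ) (x : E3) : ℝ :=
  x i * dx j φ t x - x j * dx i φ t x

/-- The boost `x^i ∂_t + t ∂_i`. -/
def boost (i : Fin 3) (φ : ℝ → E3 → ℝ) (t : ℝ) (x : E3) : ℝ :=
  x i * dt φ t x + t * dx i φ t x

/-- The scaling field `t ∂_t + x^i ∂_i`. -/
def scaling (φ : ℝ → E3 → ℝ) (t : ℝ) (x : E3) : ℝ :=
  t * dt φ t x + ∑ i : Fin 3, x i * dx i φ t x

/-- The weighted norm `‖⟨t-r⟩^{s-1} ψ(t)‖_{L²}`, with values in `[0, ∞]`. -/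
def weightedL2 (s : ℝ) (ψ : ℝ → E3 → ℝ) (t : ℝ) : ℝ≥0∞ :=
  eLpNorm (fun x : E3 => jb (t - ‖x‖) ^ (s - 1) * ψ t x) 2 volume

/-- The norm `‖φ(t)‖_{1,s-1} = ∑_{|I| ≤ 1} ‖⟨t-r⟩^{s-1} Z^I φ(t)‖_{L²}`, where `Z` runs through
the translations, rotations, boosts and the scaling field. -/
def normZ (s : ℝ) (φ : ℝ → E3 → ℝ) (t : ℝ) : ℝ≥0∞ :=
  weightedL2 s φ t
    + weightedL2 s (dt φ) t
    + ∑ i : Fin 3, weightedL2 s (dx i φ) t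
    + ∑ p : Fin 3 × Fin 3 with p.1 < p.2, weightedL2 s (rot p.1 p.2 φ) t
    + ∑ i : Fin 3, weightedL2 s (boost i φ) t
    + weightedL2 s (scaling φ) t

/-- The source term `∫_{t₁}^{t₂} ‖⟨t+r⟩^s □φ(t)‖_{L²} dt`, with values in `[0, ∞]`. -/
def sourceNorm (s : ℝ) (φ : ℝ → E3 → ℝ) (t₁ t₂ : ℝ) : ℝ≥0∞ :=
  ∫⁻ t in Icc t₁ t₂, eLpNorm (fun x : E3 => jb (t + ‖x‖) ^ s * box φ t x) 2 volume

end Morawetz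

end

/-! Write ψ = rφ, L = ∂_t + ∂_r, L̲ = ∂_t − ∂_r, f = ⟨t+r⟩^{2s}, g = ⟨t−r⟩^{2s}, and A for the
squared angular gradient of φ. In polar coordinates the wave operator reads LL̲ψ = Δ̸ψ − r□φ.
Multiply by fLψ + gL̲ψ. Since L̲f = Lg = 0, the densities X = g(L̲ψ)² + f r²A and Y = f(Lψ)² + g r²A
satisfy an identity (`energyRhs_eq`) in which ½(LX + L̲Y) consists of rotation derivatives, the work
−r□φ·(fLψ + gL̲ψ), and a bulk term [r(w'(t+r) + w'(t−r)) − (f − g)]·rA with w(q) = ⟨q⟩^{2s}. The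
rotation derivatives integrate to zero over the sphere (`integral_sphere_rot_eq_zero`). The bracket
is the error of the trapezoidal rule for w' on [t−r, t+r], and it is nonnegative for s ≥ 1 and t, r
≥ 0 (`trapezoid_wt`).

Integrate over the inside r ≤ t − c of an outgoing cone (`green_outgoing`). The axis contributes
nothing because X = Y there, and only Y crosses the cone. The later energy minus the earlier one is
flux plus bulk minus work, so the signs favour going back in time: earlier energy and flux are
bounded by later energy and work (`coneEnergy_le`). Time slices of a cone are bounded, so no
integrability at infinity is needed; letting c tend to −∞ exhausts space. Cauchy-Schwarz bounds the
work by the source norm times the root of the energy, and looking at the time of maximal energy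
closes the estimate (`cone_energy_estimate`).

The energy lacks the zeroth-order terms of the norm. Two Hardy inequalities along each ray
(`hardy_ray`, `hardy_weight_ray`) recover them at time t₁; the decay hypothesis serves only to
remove the boundary term at infinity in the first. Part (ii) is pointwise algebra: r times each
commutator field is a combination of Lψ, L̲ψ, φ, rφ and angular derivatives with coefficients that
the weights control (`normZ_le`). -/

noncomputable section

namespace Morawetz

/-! ### Polar coordinates and rotations of the sphere -/

/-- The surface measure of the unit sphere. -/
abbrev sphereMeasure : Measure (Metric.sphere (0 : E3) 1) := (volume : Measure E3).toSphere

/-- Integration in polar coordinates. -/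
lemma lintegral_eq_polar (h : E3 → ℝ≥0∞) (H : Metric.sphere (0 : E3) 1 → ℝ → ℝ≥0∞)
    (hm : Measurable (Function.uncurry H))
    (hH : ∀ w : Metric.sphere (0 : E3) 1, ∀ r : ℝ, 0 < r →
      H w r = ENNReal.ofReal (r ^ 2) * h (r • (w : E3))) :
    ∫⁻ x, h x = ∫⁻ w, (∫⁻ r in Ioi (0 : ℝ), H w r) ∂sphereMeasure := by
  have hdim : Module.finrank ℝ E3 - 1 = 2 := by simp
  have hmp := (volume : Measure E3).measurePreserving_homeomorphUnitSphereProd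
  rw [hdim] at hmp
  -- Measurability is known only for `H`. Dividing by the Jacobian r² transfers it to `h` away from
  -- the origin, which is a null set.
  have hq : ∀ p : Metric.sphere (0 : E3) 1 × Ioi (0 : ℝ),
      h ((p.2 : ℝ) • (p.1 : E3)) = (ENNReal.ofReal ((p.2 : ℝ) ^ 2))⁻¹ * H p.1 p.2 := by
    rintro ⟨w, r, hr⟩
    have hr0 : (0 : ℝ) < r ^ 2 := pow_pos hr 2
    rw [hH w r hr, ← mul_assoc, ENNReal.inv_mul_cancel (by simpa using hr.ne') ENNReal.ofReal_ne_top,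
      one_mul]
  have hm' : Measurable fun p : Metric.sphere (0 : E3) 1 × Ioi (0 : ℝ) =>
      h ((p.2 : ℝ) • (p.1 : E3)) := by
    simp_rw [hq]
    have h1 : Measurable fun p : Metric.sphere (0 : E3) 1 × Ioi (0 : ℝ) => H p.1 p.2 :=
      hm.comp (measurable_fst.prodMk (measurable_subtype_coe.comp measurable_snd))
    fun_prop
  calc ∫⁻ x, h x = ∫⁻ x : ({(0 : E3)}ᶜ : Set E3), h x ∂((volume : Measure E3).comap Subtype.val) := by
        rw [lintegral_subtype_comap (measurableSet_singleton _).compl, restrict_compl_singleton]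
    _ = ∫⁻ p, h ((p.2 : ℝ) • (p.1 : E3)) ∂(sphereMeasure.prod (Measure.volumeIoiPow 2)) := by
        rw [← hmp.lintegral_comp_emb (Homeomorph.measurableEmbedding _)]
        refine lintegral_congr fun x => ?_
        have hx : ‖(x : E3)‖ ≠ 0 := norm_ne_zero_iff.2 x.2
        simp [smul_smul, mul_inv_cancel₀ hx]
    _ = ∫⁻ w, (∫⁻ r : Ioi (0 : ℝ), h ((r : ℝ) • (w : E3)) ∂(Measure.volumeIoiPow 2))
          ∂sphereMeasure := by
        rw [lintegral_prod _ hm'.aemeasurable]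
    _ = _ := by
        refine lintegral_congr fun w => ?_
        rw [Measure.volumeIoiPow, lintegral_withDensity_eq_lintegral_mul _ (by fun_prop)
          (show Measurable fun r : Ioi (0 : ℝ) => h ((r : ℝ) • (w : E3)) from
            hm'.comp (measurable_const.prodMk measurable_id))]
        rw [← lintegral_subtype_comap measurableSet_Ioi]
        refine lintegral_congr fun r => ?_
        simp [hH w r r.2]

/-- Rotation by the angle `θ` in the `(i, j)` coordinate plane. -/
def planeRot (i j : Fin 3) (θ : ℝ) (x : E3) : E3 :=
  x + ((Real.cos θ - 1) * x i - Real.sin θ * x j) • EuclideanSpace.single i (1 : ℝ)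
    + ((Real.cos θ - 1) * x j + Real.sin θ * x i) • EuclideanSpace.single j (1 : ℝ)

lemma norm_sq_eq_sum (x : E3) : ‖x‖ ^ 2 = x 0 ^ 2 + x 1 ^ 2 + x 2 ^ 2 := by
  simp [EuclideanSpace.norm_sq_eq, Fin.sum_univ_three]

lemma norm_planeRot {i j : Fin 3} (hij : i ≠ j) (θ : ℝ) (x : E3) : ‖planeRot i j θ x‖ = ‖x‖ := by
  rw [← sq_eq_sq₀ (norm_nonneg _) (norm_nonneg _), norm_sq_eq_sum, norm_sq_eq_sum]
  have := Real.sin_sq_add_cos_sq θ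
  fin_cases i <;> fin_cases j <;> simp [planeRot] at hij ⊢ <;> ring_nf <;>
    simp only [Real.sin_sq] <;> ring

/-- `planeRot` as a linear isometry. -/
def planeRotIsometry {i j : Fin 3} (hij : i ≠ j) (θ : ℝ) : E3 →ₗᵢ[ℝ] E3 where
  toFun := planeRot i j θ
  map_add' x y := by
    simp only [planeRot, PiLp.add_apply]
    module
  map_smul' c x := by
    simp only [planeRot, PiLp.smul_apply, smul_eq_mul, RingHom.id_apply]
    module
  norm_map' := norm_planeRot hij θ

/-- `planeRot` restricted to the unit sphere. -/
def sphereRot {i j : Fin 3} (hij : i ≠ j) (θ : ℝ) (w : Metric.sphere (0 : E3) 1) :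
    Metric.sphere (0 : E3) 1 :=
  ⟨planeRot i j θ w, by simp [norm_planeRot hij]⟩

lemma continuous_planeRot (i j : Fin 3) :
    Continuous fun p : ℝ × E3 => planeRot i j p.1 p.2 := by
  unfold planeRot
  fun_prop

lemma continuous_sphereRot {i j : Fin 3} (hij : i ≠ j) :
    Continuous fun p : ℝ × Metric.sphere (0 : E3) 1 => sphereRot hij p.1 p.2 :=
  ((continuous_planeRot i j).comp
    (continuous_fst.prodMk (continuous_subtype_val.comp continuous_snd))).subtype_mk _

-- The surface measure of a set is a multiple of the volume of the solid cone over it, and a linear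
-- isometry carries cones to cones and preserves volume.
open scoped Pointwise in
lemma measurePreserving_sphereRot {i j : Fin 3} (hij : i ≠ j) (θ : ℝ) :
    MeasurePreserving (sphereRot hij θ) sphereMeasure sphereMeasure := by
  have hc : Continuous (sphereRot hij θ) :=
    (continuous_sphereRot hij).comp (continuous_const.prodMk continuous_id)
  refine ⟨hc.measurable, ?_⟩
  ext s hs
  rw [Measure.map_apply hc.measurable hs, Measure.toSphere_apply' _ hs,
    Measure.toSphere_apply' _ (hc.measurable hs)]
  set e := (planeRotIsometry hij θ).toLinearIsometryEquiv rfl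
  have hpre : Ioo (0 : ℝ) 1 • ((↑) '' (sphereRot hij θ ⁻¹' s) : Set E3)
      = e ⁻¹' (Ioo (0 : ℝ) 1 • ((↑) '' s : Set E3)) := by
    ext x
    simp only [Set.mem_smul, mem_image, mem_preimage]
    constructor
    · rintro ⟨a, ha, _, ⟨w, hw, rfl⟩, rfl⟩
      exact ⟨a, ha, _, ⟨_, hw, rfl⟩, by rw [map_smul]; rfl⟩
    · rintro ⟨a, ha, _, ⟨w, hw, rfl⟩, hx⟩
      refine ⟨a, ha, e.symm w, ⟨⟨e.symm w, by simp⟩, ?_, rfl⟩, ?_⟩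
      · have : sphereRot hij θ ⟨e.symm w, by simp⟩ = w := by
          ext1
          change e (e.symm w) = w
          simp
        change sphereRot hij θ _ ∈ s
        rwa [this]
      · have hx' : a • (w : E3) = e x := hx
        change a • e.symm (w : E3) = x
        rw [← map_smul, hx', e.symm_apply_apply]
  rw [hpre, e.measurePreserving.measure_preimage_emb e.toHomeomorph.measurableEmbedding]

/-- Fubini for a continuous function on an interval times a compact space. -/
lemma intervalIntegral_integral_swap_of_continuous {α : Type*} [TopologicalSpace α]
    [CompactSpace α] [T2Space α] [MeasurableSpace α] [BorelSpace α] [SecondCountableTopology α]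
    {μ : Measure α} [IsFiniteMeasure μ] {h : ℝ → α → ℝ} (hc : Continuous (Function.uncurry h))
    (a b : ℝ) :
    ∫ x in a..b, ∫ y, h x y ∂μ = ∫ y, (∫ x in a..b, h x y) ∂μ := by
  apply intervalIntegral_integral_swap
  have : (volume.restrict (Set.uIoc a b)).prod μ
      = ((volume : Measure ℝ).prod μ).restrict (Set.uIoc a b ×ˢ univ) := by
    rw [← Measure.prod_restrict, Measure.restrict_univ]
  rw [this]
  exact (hc.continuousOn.integrableOn_compact (isCompact_uIcc.prod isCompact_univ)).mono_set
    (prod_mono uIoc_subset_uIcc subset_rfl)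

lemma hasDerivAt_planeRot (i j : Fin 3) (hij : i ≠ j) (θ : ℝ) (x : E3) :
    HasDerivAt (fun θ => planeRot i j θ x)
      (planeRot i j θ x i • EuclideanSpace.single j (1 : ℝ)
        - planeRot i j θ x j • EuclideanSpace.single i (1 : ℝ)) θ := by
  have h1 : planeRot i j θ x i = Real.cos θ * x i - Real.sin θ * x j := by
    simp [planeRot, hij]; ring
  have h2 : planeRot i j θ x j = Real.cos θ * x j + Real.sin θ * x i := by
    simp [planeRot, hij.symm]; ring
  rw [h1, h2]
  unfold planeRot
  have hcos := (Real.hasDerivAt_cos θ).sub_const 1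
  have hsin := Real.hasDerivAt_sin θ
  have := ((((hcos.mul_const (x i)).sub (hsin.mul_const (x j))).smul_const
    (EuclideanSpace.single i (1 : ℝ))).const_add x).add
    (((hcos.mul_const (x j)).add (hsin.mul_const (x i))).smul_const
    (EuclideanSpace.single j (1 : ℝ)))
  refine this.congr_deriv ?_
  module

/-- Integration by parts on the sphere: rotation derivatives have vanishing mean. -/
lemma integral_sphere_rot_eq_zero {i j : Fin 3} (hij : i ≠ j) {h : E3 → ℝ} (hh : ContDiff ℝ 1 h) :
    ∫ w : Metric.sphere (0 : E3) 1, ((w : E3) i * fderiv ℝ h w (EuclideanSpace.single j 1)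
      - (w : E3) j * fderiv ℝ h w (EuclideanSpace.single i 1)) ∂sphereMeasure = 0 := by
  set k : Metric.sphere (0 : E3) 1 → ℝ := fun w =>
    (w : E3) i * fderiv ℝ h w (EuclideanSpace.single j 1)
      - (w : E3) j * fderiv ℝ h w (EuclideanSpace.single i 1) with hk
  have hfd : Continuous (fderiv ℝ h) := hh.continuous_fderiv one_ne_zero
  have hkc : Continuous k := by
    have h1 : Continuous fun w : Metric.sphere (0 : E3) 1 => fderiv ℝ h w :=
      hfd.comp continuous_subtype_val
    fun_prop
  have hkr : Continuous (Function.uncurry fun (θ : ℝ) w => k (sphereRot hij θ w)) :=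
    hkc.comp (continuous_sphereRot hij)
  -- Along an orbit of the rotation group `k` is the θ-derivative of `h`, so a full turn integrates
  -- to zero. Averaging over the sphere and using invariance of the measure turns this into 2π times
  -- the mean of `k`.
  have hftc : ∀ w, ∫ θ in (0 : ℝ)..(2 * Real.pi), k (sphereRot hij θ w) = 0 := by
    intro w
    have hd : ∀ θ ∈ uIcc (0 : ℝ) (2 * Real.pi),
        HasDerivAt (fun θ => h (planeRot i j θ w)) (k (sphereRot hij θ w)) θ := by
      intro θ _
      have h1 := ((hh.differentiable one_ne_zero) (planeRot i j θ w)).hasFDerivAt.comp_hasDerivAt θ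
        (hasDerivAt_planeRot i j hij θ w)
      refine h1.congr_deriv ?_
      simp only [map_sub, map_smul, smul_eq_mul]
      rfl
    rw [intervalIntegral.integral_eq_sub_of_hasDerivAt hd
      ((hkr.comp (continuous_id.prodMk continuous_const)).intervalIntegrable _ _)]
    simp [planeRot]
  have hsw := intervalIntegral_integral_swap_of_continuous (μ := sphereMeasure) hkr 0 (2 * Real.pi)
  simp only [hftc, integral_zero] at hsw
  have hinv : ∀ θ : ℝ, ∫ w, k (sphereRot hij θ w) ∂sphereMeasure = ∫ w, k w ∂sphereMeasure := by
    intro θ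
    have hmp := measurePreserving_sphereRot hij θ
    rw [← integral_map hmp.aemeasurable hkc.aestronglyMeasurable, hmp.map_eq]
  simp only [hinv, intervalIntegral.integral_const, smul_eq_mul, sub_zero] at hsw
  simpa [Real.pi_ne_zero] using hsw

/-! ### The weights and the trapezoidal inequality -/

/-- The weight `⟨q⟩^{2s} = (1 + q²)^s`. -/
def wt (s q : ℝ) : ℝ := (1 + q ^ 2) ^ s

/-- The derivative of the weight `wt s`. -/
def dwt (s q : ℝ) : ℝ := 2 * s * q * wt (s - 1) q

lemma wt_pos (s q : ℝ) : 0 < wt s q := Real.rpow_pos_of_pos (by positivity) _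

lemma jb_pos (q : ℝ) : 0 < jb q := Real.sqrt_pos.2 (by positivity)

lemma jb_sq (q : ℝ) : jb q ^ 2 = 1 + q ^ 2 := Real.sq_sqrt (by positivity)

lemma jb_rpow_two_mul (s q : ℝ) : jb q ^ (2 * s) = wt s q := by
  rw [Real.rpow_mul (jb_pos q).le, Real.rpow_two, jb_sq, wt]

lemma sq_jb_rpow (s q : ℝ) : (jb q ^ s) ^ 2 = wt s q := by
  rw [← jb_rpow_two_mul, mul_comm, Real.rpow_mul (jb_pos q).le, Real.rpow_two]

lemma wt_eq (s q : ℝ) : wt s q = (1 + q ^ 2) * wt (s - 1) q := by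
  have h : (0 : ℝ) < 1 + q ^ 2 := by positivity
  rw [wt, wt, Real.rpow_sub_one h.ne']
  field_simp

lemma wt_le_wt {s q p : ℝ} (hs : 0 ≤ s) (h : q ^ 2 ≤ p ^ 2) : wt s q ≤ wt s p :=
  Real.rpow_le_rpow (by positivity) (by linarith) hs

lemma contDiff_wt (s : ℝ) : ContDiff ℝ 2 (wt s) := by
  have h : ∀ q : ℝ, 1 + q ^ 2 ≠ 0 := fun q => by positivity
  have h' : ContDiff ℝ 2 fun q : ℝ => 1 + q ^ 2 := by fun_prop
  exact h'.rpow_const_of_ne h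

lemma continuous_wt (s : ℝ) : Continuous (wt s) := (contDiff_wt s).continuous

@[fun_prop]
lemma contDiff_wt_one (s : ℝ) : ContDiff ℝ 1 (wt s) := (contDiff_wt s).of_le (by norm_num)

@[fun_prop]
lemma continuous_wt_comp {α : Type*} [TopologicalSpace α] (s : ℝ) {f : α → ℝ}
    (hf : Continuous f) : Continuous fun x => wt s (f x) := (continuous_wt s).comp hf

@[fun_prop]
lemma continuous_dwt_comp {α : Type*} [TopologicalSpace α] (s : ℝ) {f : α → ℝ}
    (hf : Continuous f) : Continuous fun x => dwt s (f x) := by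
  unfold dwt
  fun_prop

lemma hasDerivAt_wt (s q : ℝ) : HasDerivAt (wt s) (dwt s q) q := by
  have h : (1 : ℝ) + q ^ 2 ≠ 0 := by positivity
  have h1 : HasDerivAt (fun q : ℝ => 1 + q ^ 2) (2 * q) q := by
    simpa using (hasDerivAt_pow 2 q).const_add 1
  refine (h1.rpow_const (p := s) (Or.inl h)).congr_deriv ?_
  rw [dwt, wt]
  ring

lemma hasDerivAt_dwt (s q : ℝ) :
    HasDerivAt (dwt s) (2 * s * (wt (s - 1) q + q * dwt (s - 1) q)) q := by
  have h := ((hasDerivAt_id q).const_mul (2 * s)).mul (hasDerivAt_wt (s - 1) q)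
  refine h.congr_deriv ?_
  simp
  ring

/-- The compared expression is the second derivative of the weight. It equals 2s(1+x²)^{s−1}(1 +
2(s−1)(1 − 1/(1+x²))), and for s ≥ 1 each factor is nonnegative and nondecreasing in x². -/
lemma deriv_dwt_mono {s q p : ℝ} (hs : 1 ≤ s) (h : q ^ 2 ≤ p ^ 2) :
    2 * s * (wt (s - 1) q + q * dwt (s - 1) q) ≤ 2 * s * (wt (s - 1) p + p * dwt (s - 1) p) := by
  have key : ∀ x : ℝ, wt (s - 1) x + x * dwt (s - 1) x
      = wt (s - 1) x * (1 + 2 * (s - 1) * (1 - 1 / (1 + x ^ 2))) := by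
    intro x
    have hx : (1 : ℝ) + x ^ 2 ≠ 0 := by positivity
    rw [dwt, wt_eq (s - 1) x]
    field_simp
    ring
  rw [key, key]
  have h1 : wt (s - 1) q ≤ wt (s - 1) p := wt_le_wt (by linarith) h
  have h2 : 1 / (1 + p ^ 2) ≤ 1 / (1 + q ^ 2) := by
    apply one_div_le_one_div_of_le <;> nlinarith [sq_nonneg q]
  have h3 : 1 / (1 + q ^ 2) ≤ 1 := by
    rw [div_le_one (by positivity)]
    nlinarith [sq_nonneg q]
  have h4 : (0 : ℝ) ≤ 1 + 2 * (s - 1) * (1 - 1 / (1 + q ^ 2)) := by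
    have := mul_nonneg (by linarith : (0 : ℝ) ≤ 2 * (s - 1))
      (by linarith : (0 : ℝ) ≤ 1 - 1 / (1 + q ^ 2))
    linarith
  have h5 := mul_le_mul_of_nonneg_left h2 (by linarith : (0 : ℝ) ≤ 2 * (s - 1))
  refine mul_le_mul_of_nonneg_left (mul_le_mul h1 ?_ h4 (wt_pos _ _).le) (by linarith)
  linarith

/-- The trapezoidal inequality that gives the angular bulk term of the energy identity a sign. -/
lemma trapezoid_wt {s t r : ℝ} (hs : 1 ≤ s) (ht : 0 ≤ t) (hr : 0 ≤ r) :
    0 ≤ (dwt s (t + r) + dwt s (t - r)) * r - (wt s (t + r) - wt s (t - r)) := by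
  set k : ℝ → ℝ := fun r =>
    (dwt s (t + r) + dwt s (t - r)) * r - (wt s (t + r) - wt s (t - r)) with hk
  set dd : ℝ → ℝ := fun q => 2 * s * (wt (s - 1) q + q * dwt (s - 1) q) with hdd
  -- The first derivatives of the weight cancel, leaving a difference of second derivatives; it is
  -- nonnegative because (t−x)² ≤ (t+x)² for t, x ≥ 0.
  have hd : ∀ x, HasDerivAt k (x * (dd (t + x) - dd (t - x))) x := by
    intro x
    have ha : HasDerivAt (fun r => t + r) 1 x := (hasDerivAt_id x).const_add t
    have hb : HasDerivAt (fun r => t - r) (-1) x := (hasDerivAt_id x).const_sub t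
    have h1 := (hasDerivAt_dwt s (t + x)).comp x ha
    have h2 := (hasDerivAt_dwt s (t - x)).comp x hb
    have h3 := (hasDerivAt_wt s (t + x)).comp x ha
    have h4 := (hasDerivAt_wt s (t - x)).comp x hb
    refine (((h1.add h2).mul (hasDerivAt_id x)).sub (h3.sub h4)).congr_deriv ?_
    simp [hdd]
    ring
  have hm : MonotoneOn k (Ici 0) := by
    refine monotoneOn_of_deriv_nonneg (convex_Ici 0)
      (fun x _ => (hd x).continuousAt.continuousWithinAt)
      (fun x _ => (hd x).differentiableAt.differentiableWithinAt) fun x hx => ?_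
    rw [interior_Ici] at hx
    rw [(hd x).deriv]
    have hx0 : 0 < x := hx
    refine mul_nonneg hx0.le (sub_nonneg.2 (deriv_dwt_mono hs ?_))
    nlinarith
  have h0 : k 0 = 0 := by simp [hk]
  have := hm (mem_Ici.2 le_rfl) (mem_Ici.2 hr) hr
  rw [h0] at this
  exact this

/-! ### Locality of the differential operators -/

section Locality

variable {φ ψ : ℝ → E3 → ℝ} {t : ℝ} {x : E3}

lemma eventuallyEq_time (h : Function.uncurry φ =ᶠ[𝓝 (t, x)] Function.uncurry ψ) :
    (fun τ => φ τ x) =ᶠ[𝓝 t] fun τ => ψ τ x :=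
  (Continuous.prodMk continuous_id continuous_const).continuousAt.eventually h

lemma eventuallyEq_space (h : Function.uncurry φ =ᶠ[𝓝 (t, x)] Function.uncurry ψ) :
    φ t =ᶠ[𝓝 x] ψ t :=
  (Continuous.prodMk continuous_const continuous_id).continuousAt.eventually h

lemma dt_congr (h : Function.uncurry φ =ᶠ[𝓝 (t, x)] Function.uncurry ψ) : dt φ t x = dt ψ t x :=
  (eventuallyEq_time h).deriv_eq

lemma dx_congr (i : Fin 3) (h : Function.uncurry φ =ᶠ[𝓝 (t, x)] Function.uncurry ψ) :
    dx i φ t x = dx i ψ t x := by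
  rw [dx, dx, (eventuallyEq_space h).fderiv_eq]

lemma dr_congr (h : Function.uncurry φ =ᶠ[𝓝 (t, x)] Function.uncurry ψ) :
    dr φ t x = dr ψ t x := by
  rw [dr, dr, (eventuallyEq_space h).fderiv_eq]

lemma angGrad_congr (h : Function.uncurry φ =ᶠ[𝓝 (t, x)] Function.uncurry ψ) :
    angGrad φ t x = angGrad ψ t x := by
  rw [angGrad, angGrad, dr_congr h, gradient, gradient, (eventuallyEq_space h).fderiv_eq]

lemma rMul_congr (h : Function.uncurry φ =ᶠ[𝓝 (t, x)] Function.uncurry ψ) :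
    Function.uncurry (rMul φ) =ᶠ[𝓝 (t, x)] Function.uncurry (rMul ψ) := by
  filter_upwards [h] with p hp
  exact congrArg (fun y => ‖p.2‖ * y) hp

lemma box_congr (h : Function.uncurry φ =ᶠ[𝓝 (t, x)] Function.uncurry ψ) :
    box φ t x = box ψ t x := by
  have h' := eventually_eventually_nhds.2 h
  rw [box, box, dt_congr (φ := dt φ) (ψ := dt ψ) (h'.mono fun p hp => dt_congr hp)]
  refine congrArg _ (Finset.sum_congr rfl fun i _ => ?_)
  exact dx_congr i (h'.mono fun p hp => dx_congr i hp)

end Locality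

section Congr

variable {φ ψ : ℝ → E3 → ℝ}

lemma normPlus_congr (s : ℝ) {t : ℝ}
    (h : ∀ x, Function.uncurry φ =ᶠ[𝓝 (t, x)] Function.uncurry ψ) :
    normPlus s φ t = normPlus s ψ t := by
  have h0 : ∀ x, φ t x = ψ t x := fun x => (h x).self_of_nhds
  have hr := fun x => rMul_congr (h x)
  simp only [normPlus, dL, dLbar, dt_congr (hr _), dr_congr (hr _), angGrad_congr (hr _), h0]

lemma normZ_congr (s : ℝ) {t : ℝ}
    (h : ∀ x, Function.uncurry φ =ᶠ[𝓝 (t, x)] Function.uncurry ψ) :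
    normZ s φ t = normZ s ψ t := by
  have h0 : ∀ x, φ t x = ψ t x := fun x => (h x).self_of_nhds
  simp only [normZ, weightedL2, rot, boost, scaling, dt_congr (h _), dx_congr _ (h _), h0]

lemma fluxDensity_congr (s : ℝ) {t : ℝ} {x : E3}
    (h : Function.uncurry φ =ᶠ[𝓝 (t, x)] Function.uncurry ψ) :
    fluxDensity s φ t x = fluxDensity s ψ t x := by
  have hr := rMul_congr h
  simp only [fluxDensity, dL, dt_congr hr, dr_congr hr, angGrad_congr hr]

lemma flux_congr (s R : ℝ) {t₁ t₂ : ℝ}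
    (h : ∀ t ∈ Icc t₁ t₂, ∀ x, Function.uncurry φ =ᶠ[𝓝 (t, x)] Function.uncurry ψ) :
    flux s φ R t₁ t₂ = flux s ψ R t₁ t₂ := by
  rw [flux, flux]
  have hm : MeasurableSet {t : ℝ | t ∈ Icc t₁ t₂ ∧ 0 < R - (t₂ - t)} :=
    measurableSet_Icc.inter (measurableSet_lt (f := fun _ : ℝ => (0 : ℝ)) (g := fun t => R - (t₂ - t))
      measurable_const (by fun_prop))
  refine setLIntegral_congr_fun hm fun t ht => lintegral_congr fun w => ?_
  rw [fluxDensity_congr s (h t ht.1 _)]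

lemma sourceNorm_congr (s : ℝ) {t₁ t₂ : ℝ}
    (h : ∀ t ∈ Icc t₁ t₂, ∀ x, Function.uncurry φ =ᶠ[𝓝 (t, x)] Function.uncurry ψ) :
    sourceNorm s φ t₁ t₂ = sourceNorm s ψ t₁ t₂ := by
  refine setLIntegral_congr_fun measurableSet_Icc fun t ht => ?_
  simp only [box_congr (h t ht _)]

end Congr

/-! ### Reduction to globally C² functions -/

/-- A function that is `C²` near a closed set agrees near that set with a global `C²` function. -/
lemma exists_contDiff_eventuallyEq {E : Type*} [NormedAddCommGroup E] [NormedSpace ℝ E]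
    [FiniteDimensional ℝ E] {S : Set E} (hS : IsClosed S) {f : E → ℝ}
    (hf : ∀ p ∈ S, ContDiffAt ℝ 2 f p) :
    ∃ g : E → ℝ, ContDiff ℝ 2 g ∧ ∀ p ∈ S, g =ᶠ[𝓝 p] f := by
  set U : Set E := {p | ContDiffAt ℝ 2 f p} with hU
  have hUo : IsOpen U := by
    rw [isOpen_iff_mem_nhds]
    exact fun p hp => ContDiffAt.eventually hp (by simp)
  -- The intermediate open set leaves room for the cutoff: the product χf is regular on the closure
  -- of `V`, where f is, and vanishes identically near every point outside that closure.
  obtain ⟨V, hVo, hSV, hVU⟩ := normal_exists_closure_subset hS hUo hf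
  obtain ⟨χ, hχ1, hχ0, -⟩ := exists_contMDiffMap_one_nhds_of_subset_interior (n := 2)
    (modelWithCornersSelf ℝ E) hS (hSV.trans hVo.interior_eq.ge)
  have hχ : ContDiff ℝ 2 χ := χ.contMDiff.contDiff
  refine ⟨fun p => χ p * f p, ?_, fun p hp => ?_⟩
  · rw [contDiff_iff_contDiffAt]
    intro p
    by_cases hp : p ∈ closure V
    · exact hχ.contDiffAt.mul (hVU hp)
    · have : (fun p => χ p * f p) =ᶠ[𝓝 p] fun _ => 0 := by
        filter_upwards [isClosed_closure.isOpen_compl.mem_nhds hp] with q hq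
        rw [hχ0 q fun h => hq (subset_closure h), zero_mul]
      exact contDiffAt_const.congr_of_eventuallyEq this
  · filter_upwards [(eventually_nhdsSet_iff_forall.1 hχ1) p hp] with q hq
    rw [hq, one_mul]

lemma exists_contDiff_extension {φ : ℝ → E3 → ℝ} {t₁ t₂ : ℝ}
    (hφ : ∀ t ∈ Icc t₁ t₂, ∀ x : E3, ContDiffAt ℝ 2 (Function.uncurry φ) (t, x)) :
    ∃ ψ : ℝ → E3 → ℝ, ContDiff ℝ 2 (Function.uncurry ψ) ∧
      ∀ t ∈ Icc t₁ t₂, ∀ x, Function.uncurry φ =ᶠ[𝓝 (t, x)] Function.uncurry ψ := by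
  obtain ⟨g, hg, hgf⟩ := exists_contDiff_eventuallyEq
    (isClosed_Icc.prod isClosed_univ : IsClosed (Icc t₁ t₂ ×ˢ (univ : Set E3)))
    (fun p hp => hφ p.1 hp.1 p.2)
  exact ⟨Function.curry g, by simpa using hg, fun t ht x =>
    (by simpa using (hgf (t, x) ⟨ht, mem_univ _⟩).symm)⟩

/-! ### Derivatives in space-time -/

section Calculus

variable {φ : ℝ → E3 → ℝ}

lemma dt_eq_fderiv {t : ℝ} {x : E3} (h : DifferentiableAt ℝ (Function.uncurry φ) (t, x)) :
    dt φ t x = fderiv ℝ (Function.uncurry φ) (t, x) (1, 0) := by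
  have h1 : HasDerivAt (fun τ : ℝ => (τ, x)) ((1 : ℝ), (0 : E3)) t :=
    (hasDerivAt_id t).prodMk (hasDerivAt_const t x)
  exact (HasFDerivAt.comp_hasDerivAt t h.hasFDerivAt h1).deriv

lemma fderiv_space {t : ℝ} {x : E3} (h : DifferentiableAt ℝ (Function.uncurry φ) (t, x)) (v : E3) :
    fderiv ℝ (φ t) x v = fderiv ℝ (Function.uncurry φ) (t, x) (0, v) := by
  have h1 : HasFDerivAt (fun y : E3 => (t, y)) (ContinuousLinearMap.inr ℝ ℝ E3) x :=
    hasFDerivAt_prodMk_right t x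
  have h2 : HasFDerivAt (Function.uncurry φ ∘ fun y : E3 => (t, y)) _ x :=
    HasFDerivAt.comp x h.hasFDerivAt h1
  change fderiv ℝ (Function.uncurry φ ∘ fun y : E3 => (t, y)) x v = _
  rw [h2.fderiv]
  simp

lemma dx_eq_fderiv {t : ℝ} {x : E3} (i : Fin 3)
    (h : DifferentiableAt ℝ (Function.uncurry φ) (t, x)) :
    dx i φ t x = fderiv ℝ (Function.uncurry φ) (t, x) (0, EuclideanSpace.single i 1) :=
  fderiv_space h _

lemma eq_sum_single (v : E3) : v = ∑ i, v i • EuclideanSpace.single i (1 : ℝ) := by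
  ext k
  simp [Finset.sum_apply, Pi.single_apply]

lemma fderiv_space_eq_sum (t : ℝ) (x v : E3) :
    fderiv ℝ (φ t) x v = ∑ i, v i * dx i φ t x := by
  conv_lhs => rw [eq_sum_single v]
  simp [dx]

/-- The chain rule along a curve in space-time. -/
lemma hasDerivAt_comp_curve {T : ℝ → ℝ} {X : ℝ → E3} {T' : ℝ} {X' : E3} {σ : ℝ}
    (h : DifferentiableAt ℝ (Function.uncurry φ) (T σ, X σ))
    (hT : HasDerivAt T T' σ) (hX : HasDerivAt X X' σ) :
    HasDerivAt (fun σ => φ (T σ) (X σ))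
      (T' * dt φ (T σ) (X σ) + ∑ i, X' i * dx i φ (T σ) (X σ)) σ := by
  refine (HasFDerivAt.comp_hasDerivAt σ h.hasFDerivAt (hT.prodMk hX)).congr_deriv ?_
  rw [← fderiv_space_eq_sum, fderiv_space h, dt_eq_fderiv h, ← smul_eq_mul, ← map_smul, ← map_add]
  simp

lemma contDiff_dt {n : WithTop ℕ∞} (h : ContDiff ℝ (n + 1) (Function.uncurry φ)) :
    ContDiff ℝ n (Function.uncurry (dt φ)) := by
  have : Function.uncurry (dt φ) = fun p => fderiv ℝ (Function.uncurry φ) p (1, 0) := by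
    ext ⟨t, x⟩
    exact dt_eq_fderiv (h.differentiable (by simp) _)
  rw [this]
  exact (h.fderiv_right le_rfl).clm_apply contDiff_const

lemma contDiff_dx {n : WithTop ℕ∞} (i : Fin 3) (h : ContDiff ℝ (n + 1) (Function.uncurry φ)) :
    ContDiff ℝ n (Function.uncurry (dx i φ)) := by
  have : Function.uncurry (dx i φ)
      = fun p => fderiv ℝ (Function.uncurry φ) p (0, EuclideanSpace.single i 1) := by
    ext ⟨t, x⟩
    exact dx_eq_fderiv i (h.differentiable (by simp) _)
  rw [this]
  exact (h.fderiv_right le_rfl).clm_apply contDiff_const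

lemma fderiv_fderiv_apply (h : ContDiff ℝ 2 (Function.uncurry φ)) (p v w : ℝ × E3) :
    fderiv ℝ (fun q => fderiv ℝ (Function.uncurry φ) q v) p w
      = fderiv ℝ (fun q => fderiv ℝ (Function.uncurry φ) q w) p v := by
  have hd : DifferentiableAt ℝ (fderiv ℝ (Function.uncurry φ)) p :=
    ((h.fderiv_right (m := 1) (by norm_num)).differentiable one_ne_zero) p
  have hs : IsSymmSndFDerivAt ℝ (Function.uncurry φ) p :=
    h.contDiffAt.isSymmSndFDerivAt (by simp)
  have key : ∀ v w : ℝ × E3, fderiv ℝ (fun q => fderiv ℝ (Function.uncurry φ) q v) p w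
      = fderiv ℝ (fderiv ℝ (Function.uncurry φ)) p w v := by
    intro v w
    rw [fderiv_clm_apply hd (differentiableAt_const v)]
    simp
  rw [key, key, hs.eq]

lemma dx_dt_comm (h : ContDiff ℝ 2 (Function.uncurry φ)) (i : Fin 3) (t : ℝ) (x : E3) :
    dx i (dt φ) t x = dt (dx i φ) t x := by
  have h' : ContDiff ℝ (1 + 1) (Function.uncurry φ) := by simpa [one_add_one_eq_two] using h
  have hd : Differentiable ℝ (Function.uncurry φ) := h.differentiable (by simp)
  rw [dx_eq_fderiv i ((contDiff_dt h').differentiable one_ne_zero _),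
    dt_eq_fderiv ((contDiff_dx i h').differentiable one_ne_zero _)]
  have h1 : Function.uncurry (dt φ) = fun p => fderiv ℝ (Function.uncurry φ) p (1, 0) :=
    funext fun p => dt_eq_fderiv (hd _)
  have h2 : Function.uncurry (dx i φ)
      = fun p => fderiv ℝ (Function.uncurry φ) p (0, EuclideanSpace.single i 1) :=
    funext fun p => dx_eq_fderiv i (hd _)
  rw [h1, h2, fderiv_fderiv_apply h]

lemma dx_dx_comm (h : ContDiff ℝ 2 (Function.uncurry φ)) (i j : Fin 3) (t : ℝ) (x : E3) :
    dx i (dx j φ) t x = dx j (dx i φ) t x := by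
  have h' : ContDiff ℝ (1 + 1) (Function.uncurry φ) := by simpa [one_add_one_eq_two] using h
  have hd : Differentiable ℝ (Function.uncurry φ) := h.differentiable (by simp)
  rw [dx_eq_fderiv i ((contDiff_dx j h').differentiable one_ne_zero _),
    dx_eq_fderiv j ((contDiff_dx i h').differentiable one_ne_zero _)]
  have h2 : ∀ i, Function.uncurry (dx i φ)
      = fun p => fderiv ℝ (Function.uncurry φ) p (0, EuclideanSpace.single i 1) :=
    fun i => funext fun p => dx_eq_fderiv i (hd _)
  rw [h2 i, h2 j, fderiv_fderiv_apply h]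

end Calculus

/-! ### Energy densities in polar form and the pointwise energy identity; all expressions are
polynomial in r, hence regular across r = 0 -/

/-- The spatial derivative `∑ vᵏ ∂_k ψ` in the direction `v`. -/
def dirD (ψ : ℝ → E3 → ℝ) (t : ℝ) (x v : E3) : ℝ := ∑ k, v k * dx k ψ t x

/-- `(∂_t + ∂_r)(r φ)` at `(t, r w)`, for a unit vector `w`. -/
def polL (φ : ℝ → E3 → ℝ) (t r : ℝ) (w : E3) : ℝ :=
  φ t (r • w) + r * (dt φ t (r • w) + dirD φ t (r • w) w)

/-- `(∂_t - ∂_r)(r φ)` at `(t, r w)`, for a unit vector `w`. -/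
def polLbar (φ : ℝ → E3 → ℝ) (t r : ℝ) (w : E3) : ℝ :=
  -φ t (r • w) + r * (dt φ t (r • w) - dirD φ t (r • w) w)

/-- `r⁻¹` times the rotation derivative `x^i ∂_j φ - x^j ∂_i φ` at `x = r w`. -/
def polRot (i j : Fin 3) (φ : ℝ → E3 → ℝ) (t r : ℝ) (w : E3) : ℝ :=
  w i * dx j φ t (r • w) - w j * dx i φ t (r • w)

/-- The squared norm of the angular gradient of `φ` at `r w`. -/
def polAng (φ : ℝ → E3 → ℝ) (t r : ℝ) (w : E3) : ℝ :=
  polRot 0 1 φ t r w ^ 2 + polRot 0 2 φ t r w ^ 2 + polRot 1 2 φ t r w ^ 2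

/-- The part of the energy density that is transported along outgoing rays. -/
def outDensity (s : ℝ) (φ : ℝ → E3 → ℝ) (t r : ℝ) (w : E3) : ℝ :=
  wt s (t - r) * polLbar φ t r w ^ 2 + wt s (t + r) * (r ^ 2 * polAng φ t r w)

/-- The part of the energy density that is transported along incoming rays. -/
def inDensity (s : ℝ) (φ : ℝ → E3 → ℝ) (t r : ℝ) (w : E3) : ℝ :=
  wt s (t + r) * polL φ t r w ^ 2 + wt s (t - r) * (r ^ 2 * polAng φ t r w)

/-- The multiplier `⟨t+r⟩^{2s} L(rφ) + ⟨t-r⟩^{2s} L̲(rφ)`. -/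
def multiplier (s : ℝ) (φ : ℝ → E3 → ℝ) (t r : ℝ) (w : E3) : ℝ :=
  wt s (t + r) * polL φ t r w + wt s (t - r) * polLbar φ t r w

/-- The radial wave operator `(∂_t² - ∂_r²)(r φ)` at `r w`. -/
def polWave (φ : ℝ → E3 → ℝ) (t r : ℝ) (w : E3) : ℝ :=
  -2 * dirD φ t (r • w) w
    + r * (dt (dt φ) t (r • w) - ∑ k, w k * dirD (dx k φ) t (r • w) w)

/-- The derivative of `polRot` along the ray with velocity `(1, ε)` in the `(t, r)` plane. -/
def polRotRay (ε : ℝ) (i j : Fin 3) (φ : ℝ → E3 → ℝ) (t r : ℝ) (w : E3) : ℝ :=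
  w i * (dt (dx j φ) t (r • w) + ε * dirD (dx j φ) t (r • w) w)
    - w j * (dt (dx i φ) t (r • w) + ε * dirD (dx i φ) t (r • w) w)

/-- The generator of the rotations in the `(i, j)` plane. -/
def rotV (i j : Fin 3) (w : E3) : E3 :=
  w i • EuclideanSpace.single j (1 : ℝ) - w j • EuclideanSpace.single i (1 : ℝ)

/-- The derivative of `polRot i j` in the direction `rotV i j w`. -/
def polRotRot (i j : Fin 3) (φ : ℝ → E3 → ℝ) (t r : ℝ) (w : E3) : ℝ :=
  -w j * dx j φ t (r • w) - w i * dx i φ t (r • w)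
    + r * (w i * dirD (dx j φ) t (r • w) (rotV i j w)
      - w j * dirD (dx i φ) t (r • w) (rotV i j w))

/-- The derivative of `polRot i j * multiplier` in the direction `rotV i j w`. -/
def rotFlux (s : ℝ) (i j : Fin 3) (φ : ℝ → E3 → ℝ) (t r : ℝ) (w : E3) : ℝ :=
  polRotRot i j φ t r w * multiplier s φ t r w
    + polRot i j φ t r w *
      (wt s (t + r) * (r ^ 2 * polRotRay 1 i j φ t r w + 2 * r * polRot i j φ t r w)
        + wt s (t - r) * (r ^ 2 * polRotRay (-1) i j φ t r w - 2 * r * polRot i j φ t r w))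

/-- The angular bulk term. -/
def bulk (s : ℝ) (φ : ℝ → E3 → ℝ) (t r : ℝ) (w : E3) : ℝ :=
  ((dwt s (t + r) + dwt s (t - r)) * r - (wt s (t + r) - wt s (t - r))) * (r * polAng φ t r w)

/-- The right-hand side of the pointwise energy identity. -/
def energyRhs (s : ℝ) (φ : ℝ → E3 → ℝ) (t r : ℝ) (w : E3) : ℝ :=
  (rotFlux s 0 1 φ t r w + rotFlux s 0 2 φ t r w + rotFlux s 1 2 φ t r w)
    - r * box φ t (r • w) * multiplier s φ t r w + bulk s φ t r w

section Polar

variable {φ : ℝ → E3 → ℝ}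

lemma dirD_rotV (i j : Fin 3) (t : ℝ) (x w : E3) :
    dirD φ t x (rotV i j w) = w i * dx j φ t x - w j * dx i φ t x := by
  simp [dirD, rotV, sub_mul, Finset.sum_sub_distrib]

lemma rotV_left {i j : Fin 3} (hij : i ≠ j) (w : E3) : rotV i j w i = -w j := by
  simp [rotV, hij]

lemma rotV_right {i j : Fin 3} (hij : i ≠ j) (w : E3) : rotV i j w j = w i := by
  simp [rotV, hij.symm]

lemma hasDerivAt_ray (h : Differentiable ℝ (Function.uncurry φ)) (ε t r : ℝ) (w : E3) :
    HasDerivAt (fun σ => φ (t + σ) ((r + ε * σ) • w))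
      (dt φ t (r • w) + ε * dirD φ t (r • w) w) 0 := by
  have hT : HasDerivAt (fun σ => t + σ) 1 (0 : ℝ) := (hasDerivAt_id _).const_add t
  have hX : HasDerivAt (fun σ => (r + ε * σ) • w) (ε • w) (0 : ℝ) := by
    simpa using (((hasDerivAt_id (0 : ℝ)).const_mul ε).const_add r).smul_const w
  refine (hasDerivAt_comp_curve (h _) hT hX).congr_deriv ?_
  simp [dirD, Finset.mul_sum, mul_assoc]

lemma hasDerivAt_dir (h : Differentiable ℝ (Function.uncurry φ)) (t r : ℝ) (w v : E3) :
    HasDerivAt (fun σ : ℝ => φ t (r • (w + σ • v))) (r * dirD φ t (r • w) v) 0 := by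
  have hX : HasDerivAt (fun σ : ℝ => r • (w + σ • v)) (r • v) (0 : ℝ) := by
    refine ((((hasDerivAt_id (0 : ℝ)).smul_const v).const_add w).const_smul r).congr_deriv ?_
    simp
  refine (hasDerivAt_comp_curve (h _) (hasDerivAt_const _ t) hX).congr_deriv ?_
  simp [dirD, Finset.mul_sum, mul_assoc]

variable (hφ : ContDiff ℝ 2 (Function.uncurry φ))
include hφ

lemma contDiff_dt_one : ContDiff ℝ 1 (Function.uncurry (dt φ)) :=
  contDiff_dt (by simpa [one_add_one_eq_two] using hφ)

lemma contDiff_dx_one (i : Fin 3) : ContDiff ℝ 1 (Function.uncurry (dx i φ)) :=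
  contDiff_dx i (by simpa [one_add_one_eq_two] using hφ)

lemma differentiable_self : Differentiable ℝ (Function.uncurry φ) := hφ.differentiable (by simp)

lemma differentiable_dt : Differentiable ℝ (Function.uncurry (dt φ)) :=
  (contDiff_dt_one hφ).differentiable one_ne_zero

lemma differentiable_dx (i : Fin 3) : Differentiable ℝ (Function.uncurry (dx i φ)) :=
  (contDiff_dx_one hφ i).differentiable one_ne_zero

lemma dirD_dt (t : ℝ) (x v : E3) : dirD (dt φ) t x v = ∑ k, v k * dt (dx k φ) t x := by
  simp only [dirD, dx_dt_comm hφ]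

/-- This is L̲Lψ = (∂_t² − ∂_r²)ψ, read along an incoming ray; the mixed derivatives cancel. -/
lemma hasDerivAt_polL_ray (t r : ℝ) (w : E3) :
    HasDerivAt (fun σ => polL φ (t + σ) (r + -1 * σ) w) (polWave φ t r w) 0 := by
  have hr : HasDerivAt (fun σ : ℝ => r + -1 * σ) (-1) 0 := by
    simpa using ((hasDerivAt_id (0 : ℝ)).const_mul (-1)).const_add r
  have h0 := hasDerivAt_ray (differentiable_self hφ) (-1) t r w
  have ht := hasDerivAt_ray (differentiable_dt hφ) (-1) t r w
  have hx := fun k => hasDerivAt_ray (differentiable_dx hφ k) (-1) t r w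
  have hs := HasDerivAt.fun_sum (u := Finset.univ) fun k _ => (hx k).const_mul (w k)
  refine (h0.add (hr.mul (ht.add hs))).congr_deriv ?_
  simp only [Pi.add_apply, mul_zero, add_zero, polWave, dirD_dt hφ, mul_add, Finset.sum_add_distrib]
  simp only [dirD, Fin.sum_univ_three]
  ring

lemma hasDerivAt_polLbar_ray (t r : ℝ) (w : E3) :
    HasDerivAt (fun σ => polLbar φ (t + σ) (r + 1 * σ) w) (polWave φ t r w) 0 := by
  have hr : HasDerivAt (fun σ : ℝ => r + 1 * σ) 1 0 := by
    simpa using ((hasDerivAt_id (0 : ℝ)).const_mul 1).const_add r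
  have h0 := hasDerivAt_ray (differentiable_self hφ) 1 t r w
  have ht := hasDerivAt_ray (differentiable_dt hφ) 1 t r w
  have hx := fun k => hasDerivAt_ray (differentiable_dx hφ k) 1 t r w
  have hs := HasDerivAt.fun_sum (u := Finset.univ) fun k _ => (hx k).const_mul (w k)
  refine (h0.neg.add (hr.mul (ht.sub hs))).congr_deriv ?_
  simp only [Pi.sub_apply, mul_zero, add_zero, polWave, dirD_dt hφ, mul_add, Finset.sum_add_distrib]
  simp only [dirD, Fin.sum_univ_three]
  ring

lemma hasDerivAt_polRot_ray (ε : ℝ) (i j : Fin 3) (t r : ℝ) (w : E3) :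
    HasDerivAt (fun σ => polRot i j φ (t + σ) (r + ε * σ) w) (polRotRay ε i j φ t r w) 0 :=
  ((hasDerivAt_ray (differentiable_dx hφ j) ε t r w).const_mul (w i)).sub
    ((hasDerivAt_ray (differentiable_dx hφ i) ε t r w).const_mul (w j))

lemma hasDerivAt_polAng_ray (ε t r : ℝ) (w : E3) :
    HasDerivAt (fun σ => polAng φ (t + σ) (r + ε * σ) w)
      (2 * (polRot 0 1 φ t r w * polRotRay ε 0 1 φ t r w
        + polRot 0 2 φ t r w * polRotRay ε 0 2 φ t r w
        + polRot 1 2 φ t r w * polRotRay ε 1 2 φ t r w)) 0 := by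
  refine ((((hasDerivAt_polRot_ray hφ ε 0 1 t r w).pow 2).add
    ((hasDerivAt_polRot_ray hφ ε 0 2 t r w).pow 2)).add
    ((hasDerivAt_polRot_ray hφ ε 1 2 t r w).pow 2)).congr_deriv ?_
  simp
  ring

/-- Along an outgoing ray the weight in t − r is constant, while the weight in t + r changes at
twice the rate of its argument's derivative; hence no derivative falls on the weight of (L̲ψ)². -/
lemma hasDerivAt_outDensity (s t r : ℝ) (w : E3) :
    HasDerivAt (fun σ => outDensity s φ (t + σ) (r + 1 * σ) w)
      (wt s (t - r) * (2 * polLbar φ t r w * polWave φ t r w)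
        + (2 * dwt s (t + r) * (r ^ 2 * polAng φ t r w)
          + wt s (t + r) * (2 * r * polAng φ t r w
            + r ^ 2 * (2 * (polRot 0 1 φ t r w * polRotRay 1 0 1 φ t r w
              + polRot 0 2 φ t r w * polRotRay 1 0 2 φ t r w
              + polRot 1 2 φ t r w * polRotRay 1 1 2 φ t r w))))) 0 := by
  have hr : HasDerivAt (fun σ : ℝ => r + 1 * σ) 1 0 := by
    simpa using ((hasDerivAt_id (0 : ℝ)).const_mul 1).const_add r
  have ht : HasDerivAt (fun σ : ℝ => t + σ) 1 0 := (hasDerivAt_id _).const_add t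
  have hw1 := (hasDerivAt_wt s _).comp 0 (ht.sub hr)
  have hw2 := (hasDerivAt_wt s _).comp 0 (ht.add hr)
  refine ((hw1.mul ((hasDerivAt_polLbar_ray hφ t r w).pow 2)).add
    (hw2.mul ((hr.pow 2).mul (hasDerivAt_polAng_ray hφ 1 t r w)))).congr_deriv ?_
  simp only [Pi.add_apply, Pi.sub_apply, Pi.pow_apply, Pi.mul_apply, Function.comp_apply, mul_zero,
    add_zero, Nat.cast_ofNat, Nat.add_one_sub_one, pow_one]
  ring

lemma hasDerivAt_inDensity (s t r : ℝ) (w : E3) :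
    HasDerivAt (fun σ => inDensity s φ (t + σ) (r + -1 * σ) w)
      (wt s (t + r) * (2 * polL φ t r w * polWave φ t r w)
        + (2 * dwt s (t - r) * (r ^ 2 * polAng φ t r w)
          + wt s (t - r) * (-2 * r * polAng φ t r w
            + r ^ 2 * (2 * (polRot 0 1 φ t r w * polRotRay (-1) 0 1 φ t r w
              + polRot 0 2 φ t r w * polRotRay (-1) 0 2 φ t r w
              + polRot 1 2 φ t r w * polRotRay (-1) 1 2 φ t r w))))) 0 := by
  have hr : HasDerivAt (fun σ : ℝ => r + -1 * σ) (-1) 0 := by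
    simpa using ((hasDerivAt_id (0 : ℝ)).const_mul (-1)).const_add r
  have ht : HasDerivAt (fun σ : ℝ => t + σ) 1 0 := (hasDerivAt_id _).const_add t
  have hw1 := (hasDerivAt_wt s _).comp 0 (ht.sub hr)
  have hw2 := (hasDerivAt_wt s _).comp 0 (ht.add hr)
  refine ((hw2.mul ((hasDerivAt_polL_ray hφ t r w).pow 2)).add
    (hw1.mul ((hr.pow 2).mul (hasDerivAt_polAng_ray hφ (-1) t r w)))).congr_deriv ?_
  simp only [Pi.add_apply, Pi.sub_apply, Pi.pow_apply, Pi.mul_apply, Function.comp_apply, mul_zero,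
    add_zero, Nat.cast_ofNat, Nat.add_one_sub_one, pow_one]
  ring

/-- The spherical Laplacian is the sum of the squares of the three rotations, so the left side is
Δ̸(rφ), and the identity is the polar form of the wave operator multiplied by r. -/
lemma polRotRot_sum {w : E3} (hw : ‖w‖ = 1) (t r : ℝ) :
    polRotRot 0 1 φ t r w + polRotRot 0 2 φ t r w + polRotRot 1 2 φ t r w
      = r * box φ t (r • w) + polWave φ t r w := by
  have hw' : w 0 ^ 2 + w 1 ^ 2 + w 2 ^ 2 = 1 := by rw [← norm_sq_eq_sum, hw, one_pow]
  simp only [polRotRot, polWave, box, dirD_rotV]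
  simp only [dirD, Fin.sum_univ_three, dx_dx_comm hφ 1 0, dx_dx_comm hφ 2 0, dx_dx_comm hφ 2 1]
  linear_combination (r * (dx 0 (dx 0 φ) t (r • w) + dx 1 (dx 1 φ) t (r • w)
    + dx 2 (dx 2 φ) t (r • w))) * hw'

/-- The right side is half the sum of the ray derivatives of the two densities. Replacing `polWave`
by the angular Laplacian minus r□φ and moving one rotation onto the multiplier by the product rule
leaves exactly `bulk`. -/
lemma energyRhs_eq {w : E3} (hw : ‖w‖ = 1) (s t r : ℝ) :
    energyRhs s φ t r w = (1 / 2) *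
      ((wt s (t - r) * (2 * polLbar φ t r w * polWave φ t r w)
        + (2 * dwt s (t + r) * (r ^ 2 * polAng φ t r w)
          + wt s (t + r) * (2 * r * polAng φ t r w
            + r ^ 2 * (2 * (polRot 0 1 φ t r w * polRotRay 1 0 1 φ t r w
              + polRot 0 2 φ t r w * polRotRay 1 0 2 φ t r w
              + polRot 1 2 φ t r w * polRotRay 1 1 2 φ t r w)))))
      + (wt s (t + r) * (2 * polL φ t r w * polWave φ t r w)
        + (2 * dwt s (t - r) * (r ^ 2 * polAng φ t r w)
          + wt s (t - r) * (-2 * r * polAng φ t r w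
            + r ^ 2 * (2 * (polRot 0 1 φ t r w * polRotRay (-1) 0 1 φ t r w
              + polRot 0 2 φ t r w * polRotRay (-1) 0 2 φ t r w
              + polRot 1 2 φ t r w * polRotRay (-1) 1 2 φ t r w)))))) := by
  have h := polRotRot_sum hφ hw t r
  simp only [energyRhs, rotFlux, bulk, multiplier, polAng]
  linear_combination (wt s (t + r) * polL φ t r w + wt s (t - r) * polLbar φ t r w) * h

/-! ### Derivatives along rotations -/

omit hφ in
lemma hasDerivAt_coord (w v : E3) (k : Fin 3) :
    HasDerivAt (fun σ : ℝ => (w + σ • v) k) (v k) 0 := by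
  simpa using ((hasDerivAt_id (0 : ℝ)).mul_const (v k)).const_add (w k)

lemma hasDerivAt_dirD_rot (i j : Fin 3) (t r : ℝ) (w : E3) :
    HasDerivAt (fun σ : ℝ => dirD φ t (r • (w + σ • rotV i j w)) (w + σ • rotV i j w))
      (polRot i j φ t r w + r * ∑ k, w k * dirD (dx k φ) t (r • w) (rotV i j w)) 0 := by
  have hs := HasDerivAt.fun_sum (u := Finset.univ) fun k _ =>
    (hasDerivAt_coord w (rotV i j w) k).mul
      (hasDerivAt_dir (differentiable_dx hφ k) t r w (rotV i j w))
  refine hs.congr_deriv ?_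
  rw [polRot, ← dirD_rotV, dirD, Finset.mul_sum, ← Finset.sum_add_distrib]
  refine Finset.sum_congr rfl fun k _ => ?_
  simp
  ring

/-- Rotations Ω commute with L, and Ω(rφ) = r²·`polRot`; the value is therefore L(r²·`polRot`),
expanded. -/
lemma hasDerivAt_polL_rot (i j : Fin 3) (t r : ℝ) (w : E3) :
    HasDerivAt (fun σ : ℝ => polL φ t r (w + σ • rotV i j w))
      (r ^ 2 * polRotRay 1 i j φ t r w + 2 * r * polRot i j φ t r w) 0 := by
  have h0 := hasDerivAt_dir (differentiable_self hφ) t r w (rotV i j w)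
  have ht := hasDerivAt_dir (differentiable_dt hφ) t r w (rotV i j w)
  refine (h0.add ((ht.add (hasDerivAt_dirD_rot hφ i j t r w)).const_mul r)).congr_deriv ?_
  simp only [dirD_rotV, polRot, polRotRay, dx_dt_comm hφ]
  simp only [dirD, Fin.sum_univ_three, dx_dx_comm hφ _ i, dx_dx_comm hφ _ j]
  ring

lemma hasDerivAt_polLbar_rot (i j : Fin 3) (t r : ℝ) (w : E3) :
    HasDerivAt (fun σ : ℝ => polLbar φ t r (w + σ • rotV i j w))
      (r ^ 2 * polRotRay (-1) i j φ t r w - 2 * r * polRot i j φ t r w) 0 := by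
  have h0 := hasDerivAt_dir (differentiable_self hφ) t r w (rotV i j w)
  have ht := hasDerivAt_dir (differentiable_dt hφ) t r w (rotV i j w)
  refine (h0.neg.add ((ht.sub (hasDerivAt_dirD_rot hφ i j t r w)).const_mul r)).congr_deriv ?_
  simp only [dirD_rotV, polRot, polRotRay, dx_dt_comm hφ]
  simp only [dirD, Fin.sum_univ_three, dx_dx_comm hφ _ i, dx_dx_comm hφ _ j]
  ring

lemma hasDerivAt_polRot_rot {i j : Fin 3} (hij : i ≠ j) (t r : ℝ) (w : E3) :
    HasDerivAt (fun σ : ℝ => polRot i j φ t r (w + σ • rotV i j w)) (polRotRot i j φ t r w) 0 := by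
  have hj := hasDerivAt_dir (differentiable_dx hφ j) t r w (rotV i j w)
  have hi := hasDerivAt_dir (differentiable_dx hφ i) t r w (rotV i j w)
  refine (((hasDerivAt_coord w (rotV i j w) i).mul hj).sub
    ((hasDerivAt_coord w (rotV i j w) j).mul hi)).congr_deriv ?_
  rw [polRotRot]
  simp [rotV_left hij, rotV_right hij]
  ring

lemma contDiff_rot_mul_multiplier (s : ℝ) (i j : Fin 3) (t r : ℝ) :
    ContDiff ℝ 1 fun w : E3 => polRot i j φ t r w * multiplier s φ t r w := by
  have h0 : ContDiff ℝ 1 (Function.uncurry φ) := hφ.of_le (by norm_num)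
  have ht := contDiff_dt_one hφ
  have hx := contDiff_dx_one hφ
  unfold multiplier polRot polL polLbar dirD
  fun_prop

/-- `rotFlux` is a total rotation derivative on the sphere. It may be computed along the straight
tangent line at w, although this leaves the sphere, since only the velocity at w enters. -/
lemma integral_rotFlux {i j : Fin 3} (hij : i ≠ j) (s t r : ℝ) :
    ∫ w : Metric.sphere (0 : E3) 1, rotFlux s i j φ t r w ∂sphereMeasure = 0 := by
  have hC := contDiff_rot_mul_multiplier hφ s i j t r
  rw [← integral_sphere_rot_eq_zero hij hC]
  refine integral_congr_ae (Eventually.of_forall fun w => ?_)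
  simp only
  rw [← smul_eq_mul ((w : E3) i), ← smul_eq_mul ((w : E3) j), ← map_smul, ← map_smul, ← map_sub]
  have hline : HasDerivAt (fun σ : ℝ => (w : E3) + σ • rotV i j w) (rotV i j w) 0 := by
    simpa using ((hasDerivAt_id (0 : ℝ)).smul_const (rotV i j w)).const_add (w : E3)
  have hf : HasFDerivAt (fun w : E3 => polRot i j φ t r w * multiplier s φ t r w)
      (fderiv ℝ (fun w : E3 => polRot i j φ t r w * multiplier s φ t r w) (w : E3))
      ((w : E3) + (0 : ℝ) • rotV i j w) := by
    simpa using (hC.differentiable one_ne_zero (w : E3)).hasFDerivAt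
  have h1 := HasFDerivAt.comp_hasDerivAt (0 : ℝ) hf hline
  have h2 := (hasDerivAt_polRot_rot hφ hij t r (w : E3)).mul
    (((hasDerivAt_polL_rot hφ i j t r (w : E3)).const_mul (wt s (t + r))).add
      ((hasDerivAt_polLbar_rot hφ i j t r (w : E3)).const_mul (wt s (t - r))))
  have h3 := h1.unique h2
  simp only [zero_smul, add_zero, Pi.add_apply] at h3
  rw [rotFlux, multiplier]
  exact h3.symm

lemma continuous_dt_dt : Continuous (Function.uncurry (dt (dt φ))) :=
  (contDiff_dt (n := 0) (by simpa using contDiff_dt_one hφ)).continuous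

lemma continuous_dt_dx (i : Fin 3) : Continuous (Function.uncurry (dt (dx i φ))) :=
  (contDiff_dt (n := 0) (by simpa using contDiff_dx_one hφ i)).continuous

lemma continuous_dx_dx (i j : Fin 3) : Continuous (Function.uncurry (dx i (dx j φ))) :=
  (contDiff_dx (n := 0) i (by simpa using contDiff_dx_one hφ j)).continuous

lemma continuous_polL :
    Continuous fun p : ℝ × ℝ × E3 => polL φ p.1 p.2.1 p.2.2 := by
  have h0 := hφ.continuous
  have ht := (contDiff_dt_one hφ).continuous
  have hx := fun i => (contDiff_dx_one hφ i).continuous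
  unfold polL dirD
  fun_prop

lemma continuous_polLbar :
    Continuous fun p : ℝ × ℝ × E3 => polLbar φ p.1 p.2.1 p.2.2 := by
  have h0 := hφ.continuous
  have ht := (contDiff_dt_one hφ).continuous
  have hx := fun i => (contDiff_dx_one hφ i).continuous
  unfold polLbar dirD
  fun_prop

lemma continuous_polRot (i j : Fin 3) :
    Continuous fun p : ℝ × ℝ × E3 => polRot i j φ p.1 p.2.1 p.2.2 := by
  have hx := fun i => (contDiff_dx_one hφ i).continuous
  unfold polRot
  fun_prop

lemma continuous_polAng :
    Continuous fun p : ℝ × ℝ × E3 => polAng φ p.1 p.2.1 p.2.2 := by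
  have h := continuous_polRot hφ
  unfold polAng
  fun_prop

lemma continuous_multiplier (s : ℝ) :
    Continuous fun p : ℝ × ℝ × E3 => multiplier s φ p.1 p.2.1 p.2.2 := by
  have h1 := continuous_polL hφ
  have h2 := continuous_polLbar hφ
  unfold multiplier
  fun_prop

lemma continuous_rotFlux (s : ℝ) (i j : Fin 3) :
    Continuous fun p : ℝ × ℝ × E3 => rotFlux s i j φ p.1 p.2.1 p.2.2 := by
  have h1 := continuous_multiplier hφ s
  have h2 := continuous_polRot hφ i j
  have hx := fun i => (contDiff_dx_one hφ i).continuous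
  have htx := continuous_dt_dx hφ
  have hxx := continuous_dx_dx hφ
  unfold rotFlux polRotRot polRotRay dirD rotV
  fun_prop

lemma continuous_box : Continuous (Function.uncurry (box φ)) := by
  have htt := continuous_dt_dt hφ
  have hxx := continuous_dx_dx hφ
  unfold Function.uncurry box
  fun_prop

lemma continuous_bulk (s : ℝ) :
    Continuous fun p : ℝ × ℝ × E3 => bulk s φ p.1 p.2.1 p.2.2 := by
  have h1 := continuous_polAng hφ
  unfold bulk
  fun_prop

lemma continuous_energyRhs (s : ℝ) :
    Continuous fun p : ℝ × ℝ × E3 => energyRhs s φ p.1 p.2.1 p.2.2 := by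
  have h1 := continuous_multiplier hφ s
  have h2 := continuous_rotFlux hφ s
  have h3 := continuous_box hφ
  have h4 := continuous_bulk hφ s
  unfold energyRhs
  fun_prop

end Polar

/-! ### Green's formula and the energy inequality inside outgoing cones -/

/-- Green's formula on the region `a ≤ t ≤ b`, `0 ≤ r ≤ t - c` for a pair of densities, one
transported along outgoing rays and one along incoming rays. -/
lemma green_outgoing {X Y Q : ℝ → ℝ → ℝ} {DX DY : ℝ → ℝ → ℝ}
    (hX : ContDiff ℝ 1 (Function.uncurry X)) (hY : ContDiff ℝ 1 (Function.uncurry Y))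
    (h0 : ∀ t, X t 0 = Y t 0)
    (hDX : ∀ t r, HasDerivAt (fun σ => X (t + σ) (r + 1 * σ)) (DX t r) 0)
    (hDY : ∀ t r, HasDerivAt (fun σ => Y (t + σ) (r + -1 * σ)) (DY t r) 0)
    (hQ : ∀ t r, Q t r = (1 / 2) * (DX t r + DY t r)) (hQc : Continuous (Function.uncurry Q))
    (a b c : ℝ) :
    (∫ r in (0 : ℝ)..(b - c), (1 / 2) * (X b r + Y b r))
        - ∫ r in (0 : ℝ)..(a - c), (1 / 2) * (X a r + Y a r)
      = (∫ t in a..b, Y t (t - c)) + ∫ t in a..b, ∫ r in (0 : ℝ)..(t - c), Q t r := by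
  have hline : ∀ (F : ℝ → ℝ → ℝ) (hF : ContDiff ℝ 1 (Function.uncurry F)) (T R : ℝ → ℝ)
      (T' R' σ : ℝ), HasDerivAt T T' σ → HasDerivAt R R' σ →
      HasDerivAt (fun σ => F (T σ) (R σ))
        (T' * fderiv ℝ (Function.uncurry F) (T σ, R σ) (1, 0)
          + R' * fderiv ℝ (Function.uncurry F) (T σ, R σ) (0, 1)) σ := by
    intro F hF T R T' R' σ hT hR
    refine (HasFDerivAt.comp_hasDerivAt σ
      (hF.differentiable one_ne_zero (T σ, R σ)).hasFDerivAt (hT.prodMk hR)).congr_deriv ?_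
    rw [← smul_eq_mul, ← smul_eq_mul, ← map_smul, ← map_smul, ← map_add]
    simp
  have hXc := hX.continuous_fderiv one_ne_zero
  have hYc := hY.continuous_fderiv one_ne_zero
  have hXc0 := hX.continuous
  have hYc0 := hY.continuous
  set xt : ℝ → ℝ → ℝ := fun t r => fderiv ℝ (Function.uncurry X) (t, r) (1, 0) with hxt
  set xr : ℝ → ℝ → ℝ := fun t r => fderiv ℝ (Function.uncurry X) (t, r) (0, 1) with hxr
  set yt : ℝ → ℝ → ℝ := fun t r => fderiv ℝ (Function.uncurry Y) (t, r) (1, 0) with hyt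
  set yr : ℝ → ℝ → ℝ := fun t r => fderiv ℝ (Function.uncurry Y) (t, r) (0, 1) with hyr
  have hQ' : ∀ t r, Q t r = (1 / 2) * ((xt t r + xr t r) + (yt t r - yr t r)) := by
    intro t r
    have hT : HasDerivAt (fun σ : ℝ => t + σ) 1 0 := (hasDerivAt_id _).const_add t
    have hR : ∀ ε : ℝ, HasDerivAt (fun σ : ℝ => r + ε * σ) ε 0 := fun ε => by
      simpa using ((hasDerivAt_id (0 : ℝ)).const_mul ε).const_add r
    have h1 := (hDX t r).unique (hline X hX _ _ _ _ 0 hT (hR 1))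
    have h2 := (hDY t r).unique (hline Y hY _ _ _ _ 0 hT (hR (-1)))
    simp only [add_zero, mul_zero] at h1 h2
    rw [hQ, h1, h2]
    ring
  -- The substitution r = (t − c)l maps the region with a moving endpoint to the rectangle [a, b] ×
  -- [0, 1]; `J` is the t-derivative of the rescaled energy density.
  set J : ℝ → ℝ → ℝ := fun t l =>
    (1 / 2) * (X t ((t - c) * l) + Y t ((t - c) * l))
      + (t - c) * ((1 / 2) * ((xt t ((t - c) * l) + l * xr t ((t - c) * l))
        + (yt t ((t - c) * l) + l * yr t ((t - c) * l)))) with hJ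
  have hJc : Continuous (Function.uncurry J) := by
    simp only [hJ, hxt, hxr, hyt, hyr]
    fun_prop
  have hK : ∀ l t, HasDerivAt
      (fun t => (t - c) * ((1 / 2) * (X t ((t - c) * l) + Y t ((t - c) * l)))) (J t l) t := by
    intro l t
    have hR : HasDerivAt (fun t : ℝ => (t - c) * l) l t := by
      simpa using ((hasDerivAt_id t).sub_const c).mul_const l
    have h1 := hline X hX _ _ _ _ t (hasDerivAt_id t) hR
    have h2 := hline Y hY _ _ _ _ t (hasDerivAt_id t) hR
    refine (((hasDerivAt_id t).sub_const c).mul ((h1.add h2).const_mul (1 / 2))).congr_deriv ?_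
    simp [hJ, hxt, hxr, hyt, hyr]
  -- The same `J` is, up to the source (t − c)Q, an l-derivative. Its primitive equals Y at l = 1,
  -- the flux through the cone, and vanishes at l = 0 because X = Y on the axis.
  have hM : ∀ t l, HasDerivAt
      (fun l => l * ((1 / 2) * (X t ((t - c) * l) + Y t ((t - c) * l)))
        - (1 / 2) * (X t ((t - c) * l) - Y t ((t - c) * l)))
      (J t l - (t - c) * Q t ((t - c) * l)) l := by
    intro t l
    have hR : HasDerivAt (fun l : ℝ => (t - c) * l) (t - c) l := by
      simpa using (hasDerivAt_id l).const_mul (t - c)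
    have h1 := hline X hX _ _ _ _ l (hasDerivAt_const l t) hR
    have h2 := hline Y hY _ _ _ _ l (hasDerivAt_const l t) hR
    refine (((hasDerivAt_id l).mul ((h1.add h2).const_mul (1 / 2))).sub
      ((h1.sub h2).const_mul (1 / 2))).congr_deriv ?_
    simp only [hQ', hJ, hxt, hxr, hyt, hyr, Pi.add_apply, id]
    ring
  have hinner : ∀ t, ∫ l in (0 : ℝ)..1, J t l
      = Y t (t - c) + ∫ r in (0 : ℝ)..(t - c), Q t r := by
    intro t
    have hQt : Continuous fun l => (t - c) * Q t ((t - c) * l) := by fun_prop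
    have hJt : Continuous fun l => J t l := hJc.comp (by fun_prop : Continuous fun l => (t, l))
    have h1 := intervalIntegral.integral_eq_sub_of_hasDerivAt (a := 0) (b := 1)
      (fun l _ => hM t l) ((hJt.sub hQt).intervalIntegrable _ _)
    rw [intervalIntegral.integral_sub (hJt.intervalIntegrable _ _) (hQt.intervalIntegrable _ _),
      intervalIntegral.integral_const_mul, intervalIntegral.mul_integral_comp_mul_left] at h1
    simp only [mul_one, mul_zero, h0 t] at h1
    linarith
  have hswap : ∫ t in a..b, ∫ l in (0 : ℝ)..1, J t l = ∫ l in (0 : ℝ)..1, ∫ t in a..b, J t l := by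
    refine intervalIntegral_intervalIntegral_swap ?_
    exact (hJc.continuousOn.integrableOn_compact (isCompact_uIcc.prod isCompact_uIcc)).mono_set
      (prod_mono uIoc_subset_uIcc uIoc_subset_uIcc)
  have hfst : ∀ l, ∫ t in a..b, J t l
      = (b - c) * ((1 / 2) * (X b ((b - c) * l) + Y b ((b - c) * l)))
        - (a - c) * ((1 / 2) * (X a ((a - c) * l) + Y a ((a - c) * l))) := by
    intro l
    have hJt : Continuous fun t => J t l := hJc.comp (by fun_prop : Continuous fun t => (t, l))
    exact intervalIntegral.integral_eq_sub_of_hasDerivAt (fun t _ => hK l t)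
      (hJt.intervalIntegrable _ _)
  simp only [hinner, hfst] at hswap
  have hcK : ∀ t, Continuous fun l => (t - c) * ((1 / 2) * (X t ((t - c) * l) + Y t ((t - c) * l))) :=
    fun t => by fun_prop
  have hscale : ∀ t, ∫ l in (0 : ℝ)..1, (t - c) * ((1 / 2) * (X t ((t - c) * l) + Y t ((t - c) * l)))
      = ∫ r in (0 : ℝ)..(t - c), (1 / 2) * (X t r + Y t r) := by
    intro t
    have := intervalIntegral.mul_integral_comp_mul_left (a := 0) (b := 1)
      (f := fun r => (1 / 2) * (X t r + Y t r)) (t - c)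
    rwa [mul_zero, mul_one, ← intervalIntegral.integral_const_mul] at this
  have hYt : Continuous fun t => Y t (t - c) := by fun_prop
  have hQt : Continuous fun t => ∫ r in (0 : ℝ)..(t - c), Q t r :=
    intervalIntegral.continuous_parametric_intervalIntegral_of_continuous hQc (by fun_prop)
  rw [intervalIntegral.integral_add (hYt.intervalIntegrable _ _) (hQt.intervalIntegrable _ _),
    intervalIntegral.integral_sub ((hcK b).intervalIntegrable _ _)
      ((hcK a).intervalIntegrable _ _), hscale, hscale] at hswap
  exact hswap.symm

/-- The energy at time `t` inside the outgoing cone `r = t - c`. -/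
def coneEnergy (s : ℝ) (φ : ℝ → E3 → ℝ) (c t : ℝ) : ℝ :=
  ∫ w : Metric.sphere (0 : E3) 1,
    (∫ r in (0 : ℝ)..(t - c), (1 / 2) * (outDensity s φ t r w + inDensity s φ t r w)) ∂sphereMeasure

/-- The flux through the outgoing cone `r = t - c` between the times `a` and `b`. -/
def coneFlux (s : ℝ) (φ : ℝ → E3 → ℝ) (c a b : ℝ) : ℝ :=
  ∫ w : Metric.sphere (0 : E3) 1, (∫ t in a..b, inDensity s φ t (t - c) w) ∂sphereMeasure

/-- The work done by the source term at time `t` inside the outgoing cone `r = t - c`. -/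
def coneSource (s : ℝ) (φ : ℝ → E3 → ℝ) (c t : ℝ) : ℝ :=
  ∫ w : Metric.sphere (0 : E3) 1,
    (∫ r in (0 : ℝ)..(t - c), |r * box φ t (r • (w : E3)) * multiplier s φ t r w|) ∂sphereMeasure

lemma continuous_ray_integral {F : ℝ × ℝ × E3 → ℝ} (hF : Continuous F) (c : ℝ) :
    Continuous (Function.uncurry fun (t : ℝ) (w : Metric.sphere (0 : E3) 1) =>
      ∫ r in (0 : ℝ)..(t - c), F (t, r, w)) := by
  refine intervalIntegral.continuous_parametric_intervalIntegral_of_continuous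
    (X := ℝ × Metric.sphere (0 : E3) 1) (f := fun p r => F (p.1, r, p.2)) ?_ (by fun_prop)
  unfold Function.uncurry
  fun_prop

lemma continuous_cone_integral {F : ℝ × ℝ × E3 → ℝ} (hF : Continuous F) (c : ℝ) :
    Continuous fun t => ∫ w : Metric.sphere (0 : E3) 1,
      (∫ r in (0 : ℝ)..(t - c), F (t, r, w)) ∂sphereMeasure := by
  have := continuous_parametric_integral_of_continuous (μ := sphereMeasure)
    (continuous_ray_integral hF c) isCompact_univ
  simpa only [Measure.restrict_univ] using this

section Energy

variable {φ : ℝ → E3 → ℝ} (hφ : ContDiff ℝ 2 (Function.uncurry φ))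
include hφ

lemma contDiff_outDensity (s : ℝ) (w : E3) :
    ContDiff ℝ 1 (Function.uncurry fun t r => outDensity s φ t r w) := by
  have h0 : ContDiff ℝ 1 (Function.uncurry φ) := hφ.of_le (by norm_num)
  have ht := contDiff_dt_one hφ
  have hx := contDiff_dx_one hφ
  have hw := contDiff_wt_one s
  unfold Function.uncurry outDensity polAng polRot polLbar dirD
  fun_prop

lemma contDiff_inDensity (s : ℝ) (w : E3) :
    ContDiff ℝ 1 (Function.uncurry fun t r => inDensity s φ t r w) := by
  have h0 : ContDiff ℝ 1 (Function.uncurry φ) := hφ.of_le (by norm_num)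
  have ht := contDiff_dt_one hφ
  have hx := contDiff_dx_one hφ
  have hw := contDiff_wt_one s
  unfold Function.uncurry inDensity polAng polRot polL dirD
  fun_prop

lemma continuous_outDensity (s : ℝ) :
    Continuous fun p : ℝ × ℝ × E3 => outDensity s φ p.1 p.2.1 p.2.2 := by
  have h1 := continuous_polAng hφ
  have h2 := continuous_polLbar hφ
  unfold outDensity
  fun_prop

lemma continuous_inDensity (s : ℝ) :
    Continuous fun p : ℝ × ℝ × E3 => inDensity s φ p.1 p.2.1 p.2.2 := by
  have h1 := continuous_polAng hφ
  have h2 := continuous_polL hφ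
  unfold inDensity
  fun_prop

lemma continuous_coneEnergy (s c : ℝ) : Continuous fun t => coneEnergy s φ c t := by
  have h1 := continuous_outDensity hφ s
  have h2 := continuous_inDensity hφ s
  exact continuous_cone_integral (F := fun p => (1 / 2) *
    (outDensity s φ p.1 p.2.1 p.2.2 + inDensity s φ p.1 p.2.1 p.2.2)) (by fun_prop) c

lemma energy_identity_ray (s : ℝ) {w : E3} (hw : ‖w‖ = 1) (a b c : ℝ) :
    (∫ r in (0 : ℝ)..(b - c), (1 / 2) * (outDensity s φ b r w + inDensity s φ b r w))
        - ∫ r in (0 : ℝ)..(a - c), (1 / 2) * (outDensity s φ a r w + inDensity s φ a r w)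
      = (∫ t in a..b, inDensity s φ t (t - c) w)
        + ∫ t in a..b, ∫ r in (0 : ℝ)..(t - c), energyRhs s φ t r w := by
  -- On the axis Lψ = φ, L̲ψ = −φ and the two weights agree, so incoming energy is reflected without
  -- loss.
  have h0 : ∀ t, outDensity s φ t 0 w = inDensity s φ t 0 w := fun t => by
    simp [outDensity, inDensity, polL, polLbar]
  have hc : Continuous (Function.uncurry fun t r => energyRhs s φ t r w) := by
    have := continuous_energyRhs hφ s
    unfold Function.uncurry
    fun_prop
  exact green_outgoing (contDiff_outDensity hφ s w) (contDiff_inDensity hφ s w) h0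
    (fun t r => hasDerivAt_outDensity hφ s t r w) (fun t r => hasDerivAt_inDensity hφ s t r w)
    (fun t r => energyRhs_eq hφ hw s t r) hc a b c

lemma integral_energyRhs (s t r : ℝ) :
    ∫ w : Metric.sphere (0 : E3) 1, energyRhs s φ t r w ∂sphereMeasure
      = ∫ w : Metric.sphere (0 : E3) 1,
        (bulk s φ t r w - r * box φ t (r • (w : E3)) * multiplier s φ t r w) ∂sphereMeasure := by
  have hint : ∀ {F : ℝ × ℝ × E3 → ℝ}, Continuous F →
      Integrable (fun w : Metric.sphere (0 : E3) 1 => F (t, r, w)) sphereMeasure := by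
    intro F hF
    have : Continuous fun w : Metric.sphere (0 : E3) 1 => F (t, r, w) := by fun_prop
    exact this.integrable_of_hasCompactSupport (HasCompactSupport.of_compactSpace _)
  have hR : ∀ i j, Integrable (fun w : Metric.sphere (0 : E3) 1 => rotFlux s i j φ t r w)
      sphereMeasure := fun i j => hint (continuous_rotFlux hφ s i j)
  have hbox := continuous_box hφ
  have hmul := continuous_multiplier hφ s
  have hB : Integrable (fun w : Metric.sphere (0 : E3) 1 =>
      bulk s φ t r w - r * box φ t (r • (w : E3)) * multiplier s φ t r w) sphereMeasure := by
    refine (hint (continuous_bulk hφ s)).sub (hint (F := fun p =>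
      p.2.1 * box φ p.1 (p.2.1 • p.2.2) * multiplier s φ p.1 p.2.1 p.2.2) (by fun_prop))
  have : ∀ w : E3, energyRhs s φ t r w =
      (rotFlux s 0 1 φ t r w + rotFlux s 0 2 φ t r w + rotFlux s 1 2 φ t r w)
      + (bulk s φ t r w - r * box φ t (r • w) * multiplier s φ t r w) := fun w => by
    rw [energyRhs]; ring
  simp only [this]
  rw [integral_add (((hR 0 1).fun_add (hR 0 2)).fun_add (hR 1 2)) hB,
    integral_add ((hR 0 1).fun_add (hR 0 2)) (hR 1 2), integral_add (hR 0 1) (hR 0 2),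
    integral_rotFlux hφ (by decide), integral_rotFlux hφ (by decide),
    integral_rotFlux hφ (by decide)]
  simp

/-- The energy inequality inside an outgoing cone. -/
lemma coneEnergy_le {s : ℝ} (hs : 1 ≤ s) {a b c : ℝ} (ha : 0 ≤ a) (hca : c ≤ a) (hab : a ≤ b) :
    coneEnergy s φ c a + coneFlux s φ c a b
      ≤ coneEnergy s φ c b + ∫ t in a..b, coneSource s φ c t := by
  have hint : ∀ {F : Metric.sphere (0 : E3) 1 → ℝ}, Continuous F → Integrable F sphereMeasure :=
    fun hF => hF.integrable_of_hasCompactSupport (HasCompactSupport.of_compactSpace _)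
  have hbox := continuous_box hφ
  have hmul := continuous_multiplier hφ s
  have hbulk := continuous_bulk hφ s
  have hrhs := continuous_energyRhs hφ s
  have hin := continuous_inDensity hφ s
  have hout := continuous_outDensity hφ s
  have hE : ∀ t, Continuous fun w : Metric.sphere (0 : E3) 1 =>
      ∫ r in (0 : ℝ)..(t - c), (1 / 2) * (outDensity s φ t r w + inDensity s φ t r w) := by
    intro t
    refine intervalIntegral.continuous_parametric_intervalIntegral_of_continuous ?_
      continuous_const
    unfold Function.uncurry
    fun_prop
  have hF : Continuous fun w : Metric.sphere (0 : E3) 1 =>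
      ∫ t in a..b, inDensity s φ t (t - c) w := by
    refine intervalIntegral.continuous_parametric_intervalIntegral_of_continuous ?_
      continuous_const
    unfold Function.uncurry
    fun_prop
  have hswap : ∀ {F : ℝ × ℝ × E3 → ℝ}, Continuous F → ∀ t,
      ∫ w : Metric.sphere (0 : E3) 1, (∫ r in (0 : ℝ)..(t - c), F (t, r, w)) ∂sphereMeasure
        = ∫ r in (0 : ℝ)..(t - c), ∫ w : Metric.sphere (0 : E3) 1, F (t, r, w) ∂sphereMeasure := by
    intro F hF t
    refine (intervalIntegral_integral_swap_of_continuous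
      (h := fun r (w : Metric.sphere (0 : E3) 1) => F (t, r, w)) ?_ _ _).symm
    unfold Function.uncurry
    fun_prop
  have hR : Continuous fun w : Metric.sphere (0 : E3) 1 =>
      ∫ t in a..b, ∫ r in (0 : ℝ)..(t - c), energyRhs s φ t r w := by
    refine intervalIntegral.continuous_parametric_intervalIntegral_of_continuous ?_
      continuous_const
    exact (continuous_ray_integral hrhs c).comp continuous_swap
  have hid : coneEnergy s φ c b - coneEnergy s φ c a = coneFlux s φ c a b
      + ∫ w : Metric.sphere (0 : E3) 1, (∫ t in a..b, ∫ r in (0 : ℝ)..(t - c),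
        energyRhs s φ t r w) ∂sphereMeasure := by
    rw [coneEnergy, coneEnergy, coneFlux, ← integral_sub (hint (hE b)) (hint (hE a)),
      ← integral_add (hint hF) (hint hR)]
    refine integral_congr_ae (Eventually.of_forall fun w => ?_)
    exact energy_identity_ray hφ s (by simp) a b c
  -- The rotation terms have no pointwise sign, so the sphere integral is moved innermost to
  -- annihilate them. The bulk term is then dropped by its sign, and the work is bounded by its
  -- absolute value.
  have hrhs_ge : -∫ t in a..b, coneSource s φ c t ≤ ∫ w : Metric.sphere (0 : E3) 1,
      (∫ t in a..b, ∫ r in (0 : ℝ)..(t - c), energyRhs s φ t r w) ∂sphereMeasure := by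
    rw [← intervalIntegral_integral_swap_of_continuous (continuous_ray_integral hrhs c), ← intervalIntegral.integral_neg]
    have hi1 := continuous_cone_integral hrhs c
    have hi2 : Continuous fun t => coneSource s φ c t :=
      continuous_cone_integral (F := fun p => |p.2.1 * box φ p.1 (p.2.1 • p.2.2)
        * multiplier s φ p.1 p.2.1 p.2.2|) (by fun_prop) c
    refine intervalIntegral.integral_mono_on hab (hi2.neg.intervalIntegrable _ _)
      (hi1.intervalIntegrable _ _) fun t ht => ?_
    have ht0 : 0 ≤ t := ha.trans ht.1
    have htc : 0 ≤ t - c := by linarith [ht.1]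
    rw [hswap hrhs t, coneSource, hswap (F := fun p => |p.2.1 * box φ p.1 (p.2.1 • p.2.2)
      * multiplier s φ p.1 p.2.1 p.2.2|) (by fun_prop) t, ← intervalIntegral.integral_neg]
    have hci : ∀ {F : ℝ × ℝ × E3 → ℝ}, Continuous F →
        Continuous fun r => ∫ w : Metric.sphere (0 : E3) 1, F (t, r, w) ∂sphereMeasure := by
      intro F hF
      have := continuous_parametric_integral_of_continuous (μ := sphereMeasure)
        (f := fun r (w : Metric.sphere (0 : E3) 1) => F (t, r, w))
        (by unfold Function.uncurry; fun_prop) isCompact_univ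
      simpa only [Measure.restrict_univ] using this
    refine intervalIntegral.integral_mono_on htc
      ((hci (F := fun p => |p.2.1 * box φ p.1 (p.2.1 • p.2.2)
      * multiplier s φ p.1 p.2.1 p.2.2|) (by fun_prop)).neg.intervalIntegrable _ _)
      ((hci hrhs).intervalIntegrable _ _) fun r hr => ?_
    rw [integral_energyRhs hφ, ← integral_neg]
    refine integral_mono (hint (by fun_prop)) (hint (by fun_prop)) fun w => ?_
    have hb : 0 ≤ bulk s φ t r w := by
      refine mul_nonneg (trapezoid_wt hs ht0 hr.1) (mul_nonneg hr.1 ?_)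
      unfold polAng
      positivity
    have := le_abs_self (r * box φ t (r • (w : E3)) * multiplier s φ t r w)
    simp only
    linarith
  linarith

end Energy

/-! ### The norms in polar coordinates -/

/-- The density of `normPlus` in polar coordinates. -/
def normDensity (s : ℝ) (φ : ℝ → E3 → ℝ) (t r : ℝ) (w : E3) : ℝ :=
  wt s (t + r) * (polL φ t r w ^ 2 + r ^ 2 * polAng φ t r w)
    + wt s (t - r) * (polLbar φ t r w ^ 2 + φ t (r • w) ^ 2)
    + wt (s - 1) (t - r) * (r * φ t (r • w)) ^ 2

/-- The Cartesian density of `normPlus`. -/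
def cartDensity (s : ℝ) (φ : ℝ → E3 → ℝ) (t : ℝ) (x : E3) : ℝ :=
  (jb (t + ‖x‖) ^ (2 * s) * (dL (rMul φ) t x ^ 2 + ‖angGrad (rMul φ) t x‖ ^ 2)
      + jb (t - ‖x‖) ^ (2 * s) * (dLbar (rMul φ) t x ^ 2 + φ t x ^ 2
          + (‖x‖ * φ t x) ^ 2 / jb (t - ‖x‖) ^ 2)) / ‖x‖ ^ 2

section Pointwise

variable {φ : ℝ → E3 → ℝ}

lemma polAng_nonneg (t r : ℝ) (w : E3) : 0 ≤ polAng φ t r w := by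
  unfold polAng
  positivity

lemma outDensity_nonneg (s t r : ℝ) (w : E3) : 0 ≤ outDensity s φ t r w := by
  have h1 := wt_pos s (t - r)
  have h2 := wt_pos s (t + r)
  have h3 := polAng_nonneg (φ := φ) t r w
  unfold outDensity
  positivity

lemma inDensity_nonneg (s t r : ℝ) (w : E3) : 0 ≤ inDensity s φ t r w := by
  have h1 := wt_pos s (t - r)
  have h2 := wt_pos s (t + r)
  have h3 := polAng_nonneg (φ := φ) t r w
  unfold inDensity
  positivity

variable (h : Differentiable ℝ (Function.uncurry φ))
include h

lemma differentiableAt_space (t : ℝ) (x : E3) : DifferentiableAt ℝ (φ t) x := by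
  have h' : Differentiable ℝ (φ t) :=
    h.comp (g := Function.uncurry φ) (f := fun y : E3 => (t, y)) (by fun_prop)
  exact h' x

lemma hasFDerivAt_rMul (t : ℝ) {x : E3} (hx : x ≠ 0) :
    HasFDerivAt (rMul φ t)
      (‖x‖ • fderiv ℝ (φ t) x + φ t x • (‖x‖⁻¹ • innerSL ℝ x)) x := by
  have hn : HasFDerivAt (fun y : E3 => ‖y‖) (‖x‖⁻¹ • innerSL ℝ x) x := by
    have h1 := (hasStrictFDerivAt_norm_sq x).hasFDerivAt.sqrt (by simpa using hx)
    simp only [norm_nonneg, Real.sqrt_sq] at h1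
    refine h1.congr_fderiv ?_
    ext v
    simp
    ring
  exact hn.mul (differentiableAt_space h t x).hasFDerivAt

lemma dt_rMul (t : ℝ) (x : E3) : dt (rMul φ) t x = ‖x‖ * dt φ t x := by
  have hd : DifferentiableAt ℝ (fun τ => φ τ x) t :=
    h.comp (g := Function.uncurry φ) (f := fun τ : ℝ => (τ, x)) (by fun_prop) t
  exact deriv_const_mul _ hd

lemma fderiv_rMul (t : ℝ) {r : ℝ} (hr : 0 < r) {w : E3} (hw : ‖w‖ = 1) (v : E3) :
    fderiv ℝ (rMul φ t) (r • w) v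
      = r * dirD φ t (r • w) v + φ t (r • w) * inner ℝ w v := by
  have hw0 : w ≠ 0 := fun h0 => by simp [h0] at hw
  rw [(hasFDerivAt_rMul h t (smul_ne_zero hr.ne' hw0)).fderiv]
  simp only [norm_smul, hw, Real.norm_eq_abs, abs_of_pos hr, mul_one, dirD,
    add_apply, smul_apply, fderiv_space_eq_sum,
    smul_eq_mul, innerSL_apply_apply, real_inner_smul_left]
  field_simp

lemma dr_rMul (t : ℝ) {r : ℝ} (hr : 0 < r) {w : E3} (hw : ‖w‖ = 1) :
    dr (rMul φ) t (r • w) = φ t (r • w) + r * dirD φ t (r • w) w := by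
  have hdir : (‖r • w‖⁻¹ • (r • w)) = w := by
    rw [norm_smul, hw, Real.norm_eq_abs, abs_of_pos hr, mul_one, smul_smul,
      inv_mul_cancel₀ hr.ne', one_smul]
  rw [dr, hdir, fderiv_rMul h t hr hw, real_inner_self_eq_norm_sq, hw]
  ring

lemma dL_rMul (t : ℝ) {r : ℝ} (hr : 0 < r) {w : E3} (hw : ‖w‖ = 1) :
    dL (rMul φ) t (r • w) = polL φ t r w := by
  rw [dL, dr_rMul h t hr hw, dt_rMul h, norm_smul, hw, Real.norm_eq_abs, abs_of_pos hr, polL]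
  ring

lemma dLbar_rMul (t : ℝ) {r : ℝ} (hr : 0 < r) {w : E3} (hw : ‖w‖ = 1) :
    dLbar (rMul φ) t (r • w) = polLbar φ t r w := by
  rw [dLbar, dr_rMul h t hr hw, dt_rMul h, norm_smul, hw, Real.norm_eq_abs, abs_of_pos hr, polLbar]
  ring

-- Lagrange's identity: for a unit vector w, the squared length of the part of ∇φ orthogonal to w
-- equals |w × ∇φ|².
omit h in
lemma sum_sq_angular (t r : ℝ) {w : E3} (hw : ‖w‖ = 1) :
    (dx 0 φ t (r • w) - w 0 * dirD φ t (r • w) w) ^ 2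
      + (dx 1 φ t (r • w) - w 1 * dirD φ t (r • w) w) ^ 2
      + (dx 2 φ t (r • w) - w 2 * dirD φ t (r • w) w) ^ 2 = polAng φ t r w := by
  have hw' : w 0 ^ 2 + w 1 ^ 2 + w 2 ^ 2 = 1 := by rw [← norm_sq_eq_sum, hw, one_pow]
  simp only [polAng, polRot, dirD, Fin.sum_univ_three]
  generalize dx 0 φ t (r • w) = p
  generalize dx 1 φ t (r • w) = q
  generalize dx 2 φ t (r • w) = k
  linear_combination ((w 0 * p + w 1 * q + w 2 * k) ^ 2 - (p ^ 2 + q ^ 2 + k ^ 2)) * hw'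

/-- The gradient of r is radial, so removing the radial part leaves r times the angular gradient of
φ. -/
lemma norm_sq_angGrad_rMul (t : ℝ) {r : ℝ} (hr : 0 < r) {w : E3} (hw : ‖w‖ = 1) :
    ‖angGrad (rMul φ) t (r • w)‖ ^ 2 = r ^ 2 * polAng φ t r w := by
  have hdir : (‖r • w‖⁻¹ • (r • w)) = w := by
    rw [norm_smul, hw, Real.norm_eq_abs, abs_of_pos hr, mul_one, smul_smul,
      inv_mul_cancel₀ hr.ne', one_smul]
  have hc : ∀ k : Fin 3, angGrad (rMul φ) t (r • w) k
      = r * (dx k φ t (r • w) - w k * dirD φ t (r • w) w) := by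
    intro k
    have hg : gradient (rMul φ t) (r • w) k
        = fderiv ℝ (rMul φ t) (r • w) (EuclideanSpace.single k 1) := by
      rw [← inner_gradient_left, EuclideanSpace.inner_single_right]
      simp
    rw [angGrad, hdir, dr_rMul h t hr hw]
    simp only [PiLp.sub_apply, PiLp.smul_apply, smul_eq_mul, hg, fderiv_rMul h t hr hw]
    simp only [dirD, EuclideanSpace.inner_single_right]
    simp
    ring
  rw [norm_sq_eq_sum, hc, hc, hc, ← sum_sq_angular t r hw]
  ring

/-- The factor r⁻² cancels the polar Jacobian, so the norm becomes an integral of `normDensity`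
against dr dS. -/
lemma cartDensity_eq (s t : ℝ) {r : ℝ} (hr : 0 < r) {w : E3} (hw : ‖w‖ = 1) :
    cartDensity s φ t (r • w) = normDensity s φ t r w / r ^ 2 := by
  have hn : ‖r • w‖ = r := by rw [norm_smul, hw, Real.norm_eq_abs, abs_of_pos hr, mul_one]
  rw [cartDensity, dL_rMul h t hr hw, dLbar_rMul h t hr hw, norm_sq_angGrad_rMul h t hr hw, hn,
    jb_rpow_two_mul, jb_rpow_two_mul, jb_sq, normDensity, wt_eq s (t - r)]
  have : (1 : ℝ) + (t - r) ^ 2 ≠ 0 := by positivity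
  field_simp
  ring

lemma fluxDensity_eq (s t : ℝ) {r : ℝ} (hr : 0 < r) {w : E3} (hw : ‖w‖ = 1) :
    fluxDensity s φ t (r • w) = inDensity s φ t r w := by
  have hn : ‖r • w‖ = r := by rw [norm_smul, hw, Real.norm_eq_abs, abs_of_pos hr, mul_one]
  rw [fluxDensity, dL_rMul h t hr hw, norm_sq_angGrad_rMul h t hr hw, hn,
    jb_rpow_two_mul, jb_rpow_two_mul, inDensity]

end Pointwise

section Norms

variable {φ : ℝ → E3 → ℝ}

lemma eLpNorm_two_eq {f g : E3 → ℝ} (hfg : ∀ x, f x ^ 2 = g x) :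
    eLpNorm f 2 volume = (∫⁻ x, ENNReal.ofReal (g x)) ^ (1 / 2 : ℝ) := by
  rw [eLpNorm_eq_lintegral_rpow_enorm_toReal (by simp) (by simp)]
  simp only [ENNReal.toReal_ofNat, ENNReal.rpow_ofNat]
  congr 1
  refine lintegral_congr fun x => ?_
  rw [← hfg, ← sq_abs, ENNReal.ofReal_pow (abs_nonneg _), ← Real.norm_eq_abs, ofReal_norm]

variable (hφ : ContDiff ℝ 2 (Function.uncurry φ))
include hφ

lemma continuous_normDensity (s : ℝ) :
    Continuous fun p : ℝ × ℝ × E3 => normDensity s φ p.1 p.2.1 p.2.2 := by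
  have h0 := hφ.continuous
  have h1 := continuous_polAng hφ
  have h2 := continuous_polL hφ
  have h3 := continuous_polLbar hφ
  unfold normDensity
  fun_prop

lemma normPlus_eq (s t : ℝ) :
    normPlus s φ t = (∫⁻ w : Metric.sphere (0 : E3) 1, (∫⁻ r in Ioi (0 : ℝ),
      ENNReal.ofReal (normDensity s φ t r w)) ∂sphereMeasure) ^ (1 / 2 : ℝ) := by
  have hc := continuous_normDensity hφ s
  change (∫⁻ x, ENNReal.ofReal (cartDensity s φ t x)) ^ (1 / 2 : ℝ) = _
  congr 1
  refine lintegral_eq_polar _ (fun w r => ENNReal.ofReal (normDensity s φ t r w)) ?_ ?_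
  · refine Measurable.ennreal_ofReal (Continuous.measurable ?_)
    fun_prop
  · intro w r hr
    rw [cartDensity_eq (differentiable_self hφ) s t hr (by simp), ← ENNReal.ofReal_mul (by positivity),
      mul_div_cancel₀ _ (by positivity)]

lemma eLpNorm_source_eq (s t : ℝ) :
    eLpNorm (fun x : E3 => jb (t + ‖x‖) ^ s * box φ t x) 2 volume
      = (∫⁻ w : Metric.sphere (0 : E3) 1, (∫⁻ r in Ioi (0 : ℝ),
        ENNReal.ofReal (wt s (t + r) * (r * box φ t (r • (w : E3))) ^ 2)) ∂sphereMeasure)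
          ^ (1 / 2 : ℝ) := by
  have hc := continuous_box hφ
  rw [eLpNorm_two_eq (g := fun x => wt s (t + ‖x‖) * box φ t x ^ 2)
    (fun x => by rw [mul_pow, sq_jb_rpow])]
  congr 1
  refine lintegral_eq_polar _
    (fun w r => ENNReal.ofReal (wt s (t + r) * (r * box φ t (r • (w : E3))) ^ 2)) ?_ ?_
  · refine Measurable.ennreal_ofReal (Continuous.measurable ?_)
    fun_prop
  · intro w r hr
    have hn : ‖r • (w : E3)‖ = r := by simp [norm_smul, abs_of_pos hr]
    rw [hn, ← ENNReal.ofReal_mul (by positivity)]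
    congr 1
    ring

end Norms

/-! ### Control of the commutator fields -/

/-- An unweighted lower bound for `normDensity`. -/
def baseDensity (φ : ℝ → E3 → ℝ) (t r : ℝ) (w : E3) : ℝ :=
  (1 + (t + r) ^ 2) * (polL φ t r w ^ 2 + r ^ 2 * polAng φ t r w)
    + (1 + (t - r) ^ 2) * (polLbar φ t r w ^ 2 + φ t (r • w) ^ 2) + (r * φ t (r • w)) ^ 2

section Commutators

variable {φ : ℝ → E3 → ℝ}

/-- One factor 1 + q² is split off each weight of order s; on the outgoing terms the remaining power
is lowered from t + r to t − r, using s ≥ 1 and t, r ≥ 0. -/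
lemma wt_mul_baseDensity_le {s t r : ℝ} (hs : 1 ≤ s) (ht : 0 ≤ t) (hr : 0 ≤ r) (w : E3) :
    wt (s - 1) (t - r) * baseDensity φ t r w ≤ normDensity s φ t r w := by
  have hle : wt (s - 1) (t - r) ≤ wt (s - 1) (t + r) := wt_le_wt (by linarith) (by nlinarith)
  have h3 := polAng_nonneg (φ := φ) t r w
  have hX : 0 ≤ (1 + (t + r) ^ 2) * (polL φ t r w ^ 2 + r ^ 2 * polAng φ t r w) := by positivity
  have := mul_le_mul_of_nonneg_right hle hX
  rw [baseDensity, normDensity, wt_eq s (t + r), wt_eq s (t - r)]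
  linarith

/-- Reduces each bound of part (ii) to an unweighted pointwise inequality. The factor r on ψ comes
from the r⁻² in the norm, and 3 is the root of 9. -/
lemma weightedL2_le_of_sq_le (h : Differentiable ℝ (Function.uncurry φ)) {s t : ℝ} (hs : 1 ≤ s)
    (ht : 0 ≤ t) {ψ : ℝ → E3 → ℝ}
    (hψ : ∀ r : ℝ, 0 < r → ∀ w : E3, ‖w‖ = 1 →
      (r * ψ t (r • w)) ^ 2 ≤ 9 * baseDensity φ t r w) :
    weightedL2 s ψ t ≤ 3 * normPlus s φ t := by
  rw [weightedL2, eLpNorm_two_eq (g := fun x => wt (s - 1) (t - ‖x‖) * ψ t x ^ 2)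
    (fun x => by rw [mul_pow, sq_jb_rpow])]
  change _ ≤ 3 * (∫⁻ x, ENNReal.ofReal (cartDensity s φ t x)) ^ (1 / 2 : ℝ)
  have h9 : (3 : ℝ≥0∞) = (9 : ℝ≥0∞) ^ (1 / 2 : ℝ) := by
    rw [show (9 : ℝ≥0∞) = 3 ^ (2 : ℝ) by norm_num, ← ENNReal.rpow_mul]
    norm_num
  rw [h9, ← ENNReal.mul_rpow_of_nonneg _ _ (by norm_num)]
  refine ENNReal.rpow_le_rpow ?_ (by norm_num)
  rw [← lintegral_const_mul' _ _ (by simp)]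
  refine lintegral_mono_ae ?_
  have h0 : ∀ᵐ x : E3, x ≠ 0 := by simp [ae_iff]
  filter_upwards [h0] with x hx
  have hx0 : 0 < ‖x‖ := norm_pos_iff.2 hx
  obtain ⟨r, w, hr, hw, rfl⟩ : ∃ (r : ℝ) (w : E3), 0 < r ∧ ‖w‖ = 1 ∧ x = r • w :=
    ⟨‖x‖, ‖x‖⁻¹ • x, hx0, by rw [norm_smul, norm_inv, norm_norm, inv_mul_cancel₀ hx0.ne'],
      by rw [smul_smul, mul_inv_cancel₀ hx0.ne', one_smul]⟩
  have hn : ‖r • w‖ = r := by rw [norm_smul, hw, Real.norm_eq_abs, abs_of_pos hr, mul_one]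
  rw [hn, cartDensity_eq h s t hr hw, show (9 : ℝ≥0∞) = ENNReal.ofReal 9 by simp,
    ← ENNReal.ofReal_mul (by norm_num)]
  refine ENNReal.ofReal_le_ofReal ?_
  rw [← mul_div_assoc, le_div_iff₀ (by positivity)]
  have h1 := mul_le_mul_of_nonneg_left (hψ r hr w hw) (wt_pos (s - 1) (t - r)).le
  have h2 := wt_mul_baseDensity_le (φ := φ) hs ht hr.le w
  calc _ = wt (s - 1) (t - r) * (r * ψ t (r • w)) ^ 2 := by ring
    _ ≤ 9 * (wt (s - 1) (t - r) * baseDensity φ t r w) := by linarith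
    _ ≤ _ := by linarith

lemma sq_add_five_le (a b c d e : ℝ) :
    (a + b + c + d + e) ^ 2 ≤ 5 * (a ^ 2 + b ^ 2 + c ^ 2 + d ^ 2 + e ^ 2) := by
  nlinarith [sq_nonneg (a - b), sq_nonneg (a - c), sq_nonneg (a - d), sq_nonneg (a - e),
    sq_nonneg (b - c), sq_nonneg (b - d), sq_nonneg (b - e), sq_nonneg (c - d),
    sq_nonneg (c - e), sq_nonneg (d - e)]

lemma sq_coord_le {w : E3} (hw : ‖w‖ = 1) (i : Fin 3) : w i ^ 2 ≤ 1 := by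
  have hw' : w 0 ^ 2 + w 1 ^ 2 + w 2 ^ 2 = 1 := by rw [← norm_sq_eq_sum, hw, one_pow]
  have h0 := sq_nonneg (w 0)
  have h1 := sq_nonneg (w 1)
  have h2 := sq_nonneg (w 2)
  fin_cases i <;> simp only [Fin.mk_one, Fin.zero_eta, Fin.reduceFinMk] <;> linarith

lemma sq_angular_le (t r : ℝ) {w : E3} (hw : ‖w‖ = 1) (i : Fin 3) :
    (dx i φ t (r • w) - w i * dirD φ t (r • w) w) ^ 2 ≤ polAng φ t r w := by
  have h := sum_sq_angular (φ := φ) t r hw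
  have h0 := sq_nonneg (dx 0 φ t (r • w) - w 0 * dirD φ t (r • w) w)
  have h1 := sq_nonneg (dx 1 φ t (r • w) - w 1 * dirD φ t (r • w) w)
  have h2 := sq_nonneg (dx 2 φ t (r • w) - w 2 * dirD φ t (r • w) w)
  fin_cases i <;> simp only [Fin.mk_one, Fin.zero_eta, Fin.reduceFinMk] <;> linarith

lemma sq_polRot_le (t r : ℝ) (w : E3) {i j : Fin 3} (hij : i < j) :
    polRot i j φ t r w ^ 2 ≤ polAng φ t r w := by
  have h0 := sq_nonneg (polRot 0 1 φ t r w)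
  have h1 := sq_nonneg (polRot 0 2 φ t r w)
  have h2 := sq_nonneg (polRot 1 2 φ t r w)
  unfold polAng
  fin_cases i <;> fin_cases j <;>
    simp only [Fin.mk_one, Fin.zero_eta, Fin.reduceFinMk] at hij ⊢ <;>
    first | linarith | exact absurd hij (by decide)

/-- The five elementary contributions out of which all commutator fields are built. -/
lemma sq_le_baseDensity (t r : ℝ) (w : E3) {z₁ z₂ z₃ z₄ z₅ : ℝ}
    (h₁ : z₁ ^ 2 ≤ (1 + (t + r) ^ 2) * polL φ t r w ^ 2)
    (h₂ : z₂ ^ 2 ≤ (1 + (t - r) ^ 2) * polLbar φ t r w ^ 2)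
    (h₃ : z₃ ^ 2 ≤ (1 + (t - r) ^ 2) * φ t (r • w) ^ 2)
    (h₄ : z₄ ^ 2 ≤ (r * φ t (r • w)) ^ 2)
    (h₅ : z₅ ^ 2 ≤ (1 + (t + r) ^ 2) * (r ^ 2 * polAng φ t r w)) :
    (z₁ + z₂ + z₃ + z₄ + z₅) ^ 2 ≤ 9 * baseDensity φ t r w := by
  -- Five terms cost a factor 5, which is enlarged to 9 so that the root is an integer.
  have h := sq_add_five_le z₁ z₂ z₃ z₄ z₅
  have h3 := polAng_nonneg (φ := φ) t r w
  have h0 : 0 ≤ baseDensity φ t r w := by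
    unfold baseDensity
    positivity
  unfold baseDensity at h0 ⊢
  linarith

/-- Everything follows from r∂_tφ = ½(Lψ + L̲ψ) and r∂_rφ = ½(Lψ − L̲ψ) − φ. In boosts and scaling
the large coefficients recombine: t + r meets only Lψ, and t − r meets L̲ψ. -/
lemma normZ_le (h : Differentiable ℝ (Function.uncurry φ)) {s t : ℝ} (hs : 1 ≤ s) (ht : 0 ≤ t) :
    normZ s φ t ≤ 36 * normPlus s φ t := by
  have hle : ∀ {c q m : ℝ}, c ^ 2 ≤ q ^ 2 → (c * m) ^ 2 ≤ (1 + q ^ 2) * m ^ 2 := by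
    intro c q m hc
    rw [mul_pow]
    exact mul_le_mul_of_nonneg_right (by linarith) (sq_nonneg m)
  have hle1 : ∀ {c q m : ℝ}, c ^ 2 ≤ 1 → (c * m) ^ 2 ≤ (1 + q ^ 2) * m ^ 2 := by
    intro c q m hc
    rw [mul_pow]
    exact mul_le_mul_of_nonneg_right (by nlinarith [sq_nonneg q]) (sq_nonneg m)
  have hz : ∀ {q m : ℝ}, (0 : ℝ) ^ 2 ≤ (1 + q ^ 2) * m ^ 2 := by
    intro q m
    rw [zero_pow two_ne_zero]
    positivity
  have hz4 : ∀ {m : ℝ}, (0 : ℝ) ^ 2 ≤ m ^ 2 := by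
    intro m
    rw [zero_pow two_ne_zero]
    positivity
  have hz5 : ∀ {r : ℝ} {w : E3}, (0 : ℝ) ^ 2 ≤ (1 + (t + r) ^ 2) * (r ^ 2 * polAng φ t r w) := by
    intro r w
    have := polAng_nonneg (φ := φ) t r w
    rw [zero_pow two_ne_zero]
    positivity
  have hang : ∀ {c r A : ℝ} {w : E3}, c ^ 2 ≤ 1 + (t + r) ^ 2 → A ^ 2 ≤ polAng φ t r w →
      (c * (r * A)) ^ 2 ≤ (1 + (t + r) ^ 2) * (r ^ 2 * polAng φ t r w) := by
    intro c r A w hc hA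
    rw [mul_pow, mul_pow]
    exact mul_le_mul hc (mul_le_mul_of_nonneg_left hA (sq_nonneg _)) (by positivity)
      (by positivity)
  have h0 : weightedL2 s φ t ≤ 3 * normPlus s φ t := by
    refine weightedL2_le_of_sq_le h hs ht fun r hr w hw => ?_
    refine le_trans (le_of_eq ?_) (sq_le_baseDensity t r w hz hz hz (z₄ := r * φ t (r • w))
      le_rfl hz5)
    ring
  have h1 : weightedL2 s (dt φ) t ≤ 3 * normPlus s φ t := by
    refine weightedL2_le_of_sq_le h hs ht fun r hr w hw => ?_
    refine le_trans (le_of_eq ?_) (sq_le_baseDensity t r w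
      (hle1 (c := 1 / 2) (by norm_num)) (hle1 (c := 1 / 2) (by norm_num)) hz hz4 hz5)
    simp only [polL, polLbar]
    ring
  have h2 : ∀ i, weightedL2 s (dx i φ) t ≤ 3 * normPlus s φ t := by
    intro i
    refine weightedL2_le_of_sq_le h hs ht fun r hr w hw => ?_
    have hi := sq_coord_le hw i
    refine le_trans (le_of_eq ?_) (sq_le_baseDensity t r w
      (hle1 (c := w i / 2) (by nlinarith)) (hle1 (c := -(w i) / 2) (by nlinarith))
      (hle1 (c := -(w i)) (by nlinarith)) hz4
      (hang (c := 1) (by nlinarith [sq_nonneg (t + r)]) (sq_angular_le t r hw i)))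
    simp only [polL, polLbar]
    ring
  have h3 : ∀ i j, i < j → weightedL2 s (rot i j φ) t ≤ 3 * normPlus s φ t := by
    intro i j hij
    refine weightedL2_le_of_sq_le h hs ht fun r hr w hw => ?_
    refine le_trans (le_of_eq ?_) (sq_le_baseDensity t r w hz hz hz hz4
      (hang (c := r) (by nlinarith) (sq_polRot_le t r w hij)))
    simp only [rot, polRot, PiLp.smul_apply, smul_eq_mul]
    ring
  have h4 : ∀ i, weightedL2 s (boost i φ) t ≤ 3 * normPlus s φ t := by
    intro i
    refine weightedL2_le_of_sq_le h hs ht fun r hr w hw => ?_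
    have hi := sq_coord_le hw i
    have hu := sq_nonneg (t - r)
    have hv := sq_nonneg (t + r)
    have hm : ∀ {y q : ℝ}, y ^ 2 ≤ 1 → (q * y) ^ 2 ≤ q ^ 2 := by
      intro y q hy
      rw [mul_pow]
      nlinarith [sq_nonneg q]
    -- The boost produces −tφ, whose coefficient is too large for either zeroth-order term alone; it
    -- is split as −(t − r)φ − rφ.
    refine le_trans (le_of_eq ?_) (sq_le_baseDensity t r w
      (hle (c := (t + r) * (w i / 2)) (hm (by nlinarith)))
      (hle (c := (t - r) * (-(w i) / 2)) (hm (by nlinarith)))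
      (hle (c := (t - r) * -(w i)) (hm (by nlinarith)))
      (z₄ := (r * φ t (r • w)) * -(w i)) (hm (by nlinarith))
      (hang (c := t) (by nlinarith) (sq_angular_le t r hw i)))
    simp only [boost, polL, polLbar, PiLp.smul_apply, smul_eq_mul]
    ring
  have h5 : weightedL2 s (scaling φ) t ≤ 3 * normPlus s φ t := by
    refine weightedL2_le_of_sq_le h hs ht fun r hr w hw => ?_
    have hu := sq_nonneg (t - r)
    have hv := sq_nonneg (t + r)
    refine le_trans (le_of_eq ?_) (sq_le_baseDensity t r w
      (hle (c := (t + r) / 2) (by nlinarith)) (hle (c := (t - r) / 2) (by nlinarith)) hz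
      (z₄ := -(r * φ t (r • w))) (by rw [neg_sq]) hz5)
    have : ∑ i : Fin 3, (r • w) i * dx i φ t (r • w) = r * dirD φ t (r • w) w := by
      simp only [dirD, Finset.mul_sum, PiLp.smul_apply, smul_eq_mul, mul_assoc]
    simp only [scaling, polL, polLbar, this]
    ring
  have hs2 := Finset.sum_le_sum (s := Finset.univ) fun i _ => h2 i
  have hs4 := Finset.sum_le_sum (s := Finset.univ) fun i _ => h4 i
  have hs3 := Finset.sum_le_sum (s := Finset.univ.filter fun p : Fin 3 × Fin 3 => p.1 < p.2)
    fun p hp => h3 p.1 p.2 (Finset.mem_filter.1 hp).2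
  have hcard : (Finset.univ.filter fun p : Fin 3 × Fin 3 => p.1 < p.2).card = 3 := by decide
  simp only [Finset.sum_const, hcard, Finset.card_univ, Fintype.card_fin, nsmul_eq_mul] at hs2 hs3 hs4
  -- There are twelve terms, 1 + 1 + 3 + 3 + 3 + 1, each costing 3.
  calc normZ s φ t ≤ 3 * normPlus s φ t + 3 * normPlus s φ t + (3 : ℕ) * (3 * normPlus s φ t)
        + (3 : ℕ) * (3 * normPlus s φ t) + (3 : ℕ) * (3 * normPlus s φ t)
        + 3 * normPlus s φ t := by
        unfold normZ
        gcongr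
    _ = 36 * normPlus s φ t := by
        push_cast
        ring

end Commutators

/-! ### Hardy inequalities along rays -/

lemma lintegral_Ioi_eq_iSup (f : ℝ → ℝ≥0∞) :
    ∫⁻ r in Ioi (0 : ℝ), f r = ⨆ n : ℕ, ∫⁻ r in Ioc (0 : ℝ) n, f r := by
  have hU : Ioi (0 : ℝ) = ⋃ n : ℕ, Ioc (0 : ℝ) n := by
    ext x
    simp only [mem_Ioi, mem_iUnion, mem_Ioc]
    exact ⟨fun hx => (exists_nat_ge x).imp fun n hn => ⟨hx, hn⟩, fun ⟨_, hx, _⟩ => hx⟩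
  have hd : Monotone fun n : ℕ => Ioc (0 : ℝ) n :=
    fun m n hmn => Ioc_subset_Ioc_right (by exact_mod_cast hmn)
  rw [hU, setLIntegral_iUnion_of_directed _ hd.directed_le]

lemma ofReal_intervalIntegral {f : ℝ → ℝ} (hf : Continuous f) (h0 : ∀ x, 0 ≤ f x) {a b : ℝ}
    (hab : a ≤ b) :
    ENNReal.ofReal (∫ r in a..b, f r) = ∫⁻ r in Ioc a b, ENNReal.ofReal (f r) := by
  rw [intervalIntegral.integral_of_le hab, ofReal_integral_eq_lintegral_ofReal]
  · exact (hf.integrableOn_Icc).mono_set Ioc_subset_Icc_self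
  · exact Eventually.of_forall h0

section Hardy

variable {s t : ℝ} {p p' : ℝ → ℝ}

/-- Integrate the derivative of (t−r)⟨t−r⟩^{2s−2}(rp)². The derivative of the first two factors is
at most −⟨t−r⟩^{2s−2} as s ≥ 1, and the cross term is absorbed by completing the square. The
boundary term at R survives because t − R may be negative. -/
lemma hardy_interval (hs : 1 ≤ s) (hp : ∀ r, HasDerivAt p (p' r) r) (hp' : Continuous p') {R : ℝ}
    (hR : 0 ≤ R) :
    ∫ r in (0 : ℝ)..R, wt (s - 1) (t - r) * (r * p r) ^ 2
      ≤ 4 * (∫ r in (0 : ℝ)..R, wt s (t - r) * (p r + r * p' r) ^ 2)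
        + 2 * (|t - R| * wt (s - 1) (t - R) * (R * p R) ^ 2) := by
  have hpc : Continuous p := continuous_iff_continuousAt.2 fun r => (hp r).continuousAt
  have hd : ∀ r, HasDerivAt (fun r => (t - r) * wt (s - 1) (t - r) * (r * p r) ^ 2)
      (-(wt (s - 1) (t - r) + (t - r) * dwt (s - 1) (t - r)) * (r * p r) ^ 2
        + 2 * ((t - r) * wt (s - 1) (t - r)) * (r * p r) * (p r + r * p' r)) r := by
    intro r
    have hu : HasDerivAt (fun r => t - r) (-1) r := (hasDerivAt_id r).const_sub t
    have hw := (hasDerivAt_wt (s - 1) (t - r)).comp r hu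
    refine ((hu.mul hw).mul (((hasDerivAt_id r).mul (hp r)).pow 2)).congr_deriv ?_
    simp only [Pi.pow_apply, Pi.mul_apply, Function.comp_apply, Nat.cast_ofNat,
      Nat.add_one_sub_one, pow_one, id]
    ring
  have hi := intervalIntegral.integral_eq_sub_of_hasDerivAt (a := 0) (b := R) (fun r _ => hd r)
    (Continuous.intervalIntegrable (by fun_prop) _ _)
  have hc1 : Continuous fun r => wt (s - 1) (t - r) * (r * p r) ^ 2 := by fun_prop
  have hc2 : Continuous fun r => wt s (t - r) * (p r + r * p' r) ^ 2 := by fun_prop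
  have hmono : (∫ r in (0 : ℝ)..R,
      (-(wt (s - 1) (t - r) + (t - r) * dwt (s - 1) (t - r)) * (r * p r) ^ 2
        + 2 * ((t - r) * wt (s - 1) (t - r)) * (r * p r) * (p r + r * p' r)))
      ≤ ∫ r in (0 : ℝ)..R, (-(1 / 2) * (wt (s - 1) (t - r) * (r * p r) ^ 2)
        + 2 * (wt s (t - r) * (p r + r * p' r) ^ 2)) := by
    refine intervalIntegral.integral_mono_on hR (Continuous.intervalIntegrable (by fun_prop) _ _)
      (Continuous.intervalIntegrable (by fun_prop) _ _) fun r _ => ?_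
    have ha := wt_pos (s - 1) (t - r)
    have hd0 : 0 ≤ (t - r) * dwt (s - 1) (t - r) := by
      have := wt_pos (s - 1 - 1) (t - r)
      rw [dwt]
      have h2 : 0 ≤ (2 * (s - 1)) * ((t - r) ^ 2 * wt (s - 1 - 1) (t - r)) :=
        mul_nonneg (by linarith) (by positivity)
      linarith
    have h1 := mul_nonneg hd0 (sq_nonneg (r * p r))
    have h2 := mul_nonneg ha.le (sq_nonneg (r * p r - 2 * (t - r) * (p r + r * p' r)))
    have h3 := mul_nonneg ha.le (sq_nonneg (p r + r * p' r))
    rw [wt_eq s]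
    nlinarith
  rw [hi, intervalIntegral.integral_add (Continuous.intervalIntegrable (by fun_prop) _ _)
    (Continuous.intervalIntegrable (by fun_prop) _ _), intervalIntegral.integral_const_mul,
    intervalIntegral.integral_const_mul] at hmono
  have habs : -(|t - R| * wt (s - 1) (t - R) * (R * p R) ^ 2)
      ≤ (t - R) * wt (s - 1) (t - R) * (R * p R) ^ 2 := by
    have := mul_nonneg (wt_pos (s - 1) (t - R)).le (sq_nonneg (R * p R))
    have := mul_le_mul_of_nonneg_right (neg_abs_le (t - R)) this
    linarith
  simp only [zero_mul, ne_eq, OfNat.ofNat_ne_zero, not_false_eq_true, zero_pow, mul_zero,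
    sub_zero] at hmono
  linarith

/-- Integrate the derivative of ⟨t−r⟩^{2s}·r p², using p² + 2rpp' = 2p(rp)' − p². Here the boundary
term at R is nonnegative and can be dropped, so no decay is needed; the derivative of the weight
produces the last term, with constant s². -/
lemma hardy_weight_interval (hp : ∀ r, HasDerivAt p (p' r) r) (hp' : Continuous p') {R : ℝ}
    (hR : 0 ≤ R) :
    ∫ r in (0 : ℝ)..R, wt s (t - r) * p r ^ 2
      ≤ 8 * (∫ r in (0 : ℝ)..R, wt s (t - r) * (p r + r * p' r) ^ 2)
        + 8 * s ^ 2 * ∫ r in (0 : ℝ)..R, wt (s - 1) (t - r) * (r * p r) ^ 2 := by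
  have hpc : Continuous p := continuous_iff_continuousAt.2 fun r => (hp r).continuousAt
  have hd : ∀ r, HasDerivAt (fun r => wt s (t - r) * (r * p r ^ 2))
      (-dwt s (t - r) * (r * p r ^ 2) + wt s (t - r) * (p r ^ 2 + r * (2 * p r * p' r))) r := by
    intro r
    have hu : HasDerivAt (fun r => t - r) (-1) r := (hasDerivAt_id r).const_sub t
    have hw := (hasDerivAt_wt s (t - r)).comp r hu
    refine (hw.mul ((hasDerivAt_id r).mul ((hp r).pow 2))).congr_deriv ?_
    simp only [Pi.pow_apply, Pi.mul_apply, Function.comp_apply, Nat.cast_ofNat,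
      Nat.add_one_sub_one, pow_one, id]
    ring
  have hi := intervalIntegral.integral_eq_sub_of_hasDerivAt (a := 0) (b := R) (fun r _ => hd r)
    (Continuous.intervalIntegrable (by fun_prop) _ _)
  have hmono : (∫ r in (0 : ℝ)..R, (-dwt s (t - r) * (r * p r ^ 2)
      + wt s (t - r) * (p r ^ 2 + r * (2 * p r * p' r))))
      ≤ ∫ r in (0 : ℝ)..R, (-(1 / 2) * (wt s (t - r) * p r ^ 2)
        + 4 * (wt s (t - r) * (p r + r * p' r) ^ 2)
        + 4 * s ^ 2 * (wt (s - 1) (t - r) * (r * p r) ^ 2)) := by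
    refine intervalIntegral.integral_mono_on hR (Continuous.intervalIntegrable (by fun_prop) _ _)
      (Continuous.intervalIntegrable (by fun_prop) _ _) fun r _ => ?_
    have ha := (wt_pos (s - 1) (t - r)).le
    have h1 := mul_nonneg ha (sq_nonneg ((1 / 2) * (t - r) * p r + 2 * s * (r * p r)))
    have h2 := mul_nonneg ha (sq_nonneg (p r))
    have h3 := mul_nonneg (mul_nonneg ha (by positivity : 0 ≤ 1 + (t - r) ^ 2))
      (sq_nonneg ((1 / 2) * p r - 2 * (p r + r * p' r)))
    rw [dwt, wt_eq s]
    nlinarith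
  rw [hi, intervalIntegral.integral_add (Continuous.intervalIntegrable (by fun_prop) _ _)
    (Continuous.intervalIntegrable (by fun_prop) _ _),
    intervalIntegral.integral_add (Continuous.intervalIntegrable (by fun_prop) _ _)
    (Continuous.intervalIntegrable (by fun_prop) _ _), intervalIntegral.integral_const_mul,
    intervalIntegral.integral_const_mul, intervalIntegral.integral_const_mul] at hmono
  have hpos : 0 ≤ wt s (t - R) * (R * p R ^ 2) :=
    mul_nonneg (wt_pos _ _).le (mul_nonneg hR (sq_nonneg _))
  simp only [zero_mul, mul_zero, sub_zero] at hmono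
  linarith

lemma hardy_ray (hs : 1 ≤ s) (hp : ∀ r, HasDerivAt p (p' r) r) (hp' : Continuous p')
    (hlim : Tendsto (fun R => |t - R| * wt (s - 1) (t - R) * (R * p R) ^ 2) atTop (𝓝 0)) :
    ∫⁻ r in Ioi (0 : ℝ), ENNReal.ofReal (wt (s - 1) (t - r) * (r * p r) ^ 2)
      ≤ 4 * ∫⁻ r in Ioi (0 : ℝ), ENNReal.ofReal (wt s (t - r) * (p r + r * p' r) ^ 2) := by
  have hpc : Continuous p := continuous_iff_continuousAt.2 fun r => (hp r).continuousAt
  have hw0 := fun q => (wt_pos (s - 1) q).le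
  have hw1 := fun q => (wt_pos s q).le
  set G := ∫⁻ r in Ioi (0 : ℝ), ENNReal.ofReal (wt s (t - r) * (p r + r * p' r) ^ 2)
  rw [lintegral_Ioi_eq_iSup]
  refine iSup_le fun n => ?_
  -- The integral up to n is bounded by the interval inequality with any endpoint R ≥ n; letting R
  -- tend to infinity removes the boundary term without assuming either side finite.
  have hT : Tendsto (fun R => 4 * G
      + ENNReal.ofReal (2 * (|t - R| * wt (s - 1) (t - R) * (R * p R) ^ 2))) atTop
      (𝓝 (4 * G + ENNReal.ofReal (2 * 0))) :=
    tendsto_const_nhds.add (ENNReal.tendsto_ofReal (hlim.const_mul 2))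
  rw [mul_zero, ENNReal.ofReal_zero, add_zero] at hT
  refine ge_of_tendsto hT ?_
  filter_upwards [eventually_ge_atTop (n : ℝ)] with R hR
  have hR0 : 0 ≤ R := (Nat.cast_nonneg n).trans hR
  have hI : 0 ≤ ∫ r in (0 : ℝ)..R, wt s (t - r) * (p r + r * p' r) ^ 2 :=
    intervalIntegral.integral_nonneg hR0 fun r _ => mul_nonneg (hw1 _) (sq_nonneg _)
  calc ∫⁻ r in Ioc (0 : ℝ) n, ENNReal.ofReal (wt (s - 1) (t - r) * (r * p r) ^ 2)
      ≤ ∫⁻ r in Ioc (0 : ℝ) R, ENNReal.ofReal (wt (s - 1) (t - r) * (r * p r) ^ 2) :=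
        lintegral_mono_set (Ioc_subset_Ioc_right hR)
    _ = ENNReal.ofReal (∫ r in (0 : ℝ)..R, wt (s - 1) (t - r) * (r * p r) ^ 2) :=
        (ofReal_intervalIntegral (by fun_prop)
          (fun r => mul_nonneg (hw0 _) (sq_nonneg _)) hR0).symm
    _ ≤ ENNReal.ofReal (4 * (∫ r in (0 : ℝ)..R, wt s (t - r) * (p r + r * p' r) ^ 2)
        + 2 * (|t - R| * wt (s - 1) (t - R) * (R * p R) ^ 2)) :=
        ENNReal.ofReal_le_ofReal (hardy_interval hs hp hp' hR0)
    _ ≤ 4 * G + ENNReal.ofReal (2 * (|t - R| * wt (s - 1) (t - R) * (R * p R) ^ 2)) := by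
        have h4 : ENNReal.ofReal 4 = 4 := by simp
        refine ENNReal.ofReal_add_le.trans (add_le_add_left ?_ _)
        rw [ENNReal.ofReal_mul (by norm_num), h4, ofReal_intervalIntegral (by fun_prop)
          (fun r => mul_nonneg (hw1 _) (sq_nonneg _)) hR0]
        exact mul_le_mul_right (lintegral_mono_set Ioc_subset_Ioi_self) _

lemma hardy_weight_ray (hp : ∀ r, HasDerivAt p (p' r) r) (hp' : Continuous p') :
    ∫⁻ r in Ioi (0 : ℝ), ENNReal.ofReal (wt s (t - r) * p r ^ 2)
      ≤ 8 * (∫⁻ r in Ioi (0 : ℝ), ENNReal.ofReal (wt s (t - r) * (p r + r * p' r) ^ 2))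
        + ENNReal.ofReal (8 * s ^ 2) *
          ∫⁻ r in Ioi (0 : ℝ), ENNReal.ofReal (wt (s - 1) (t - r) * (r * p r) ^ 2) := by
  have hpc : Continuous p := continuous_iff_continuousAt.2 fun r => (hp r).continuousAt
  have hw0 := fun q => (wt_pos (s - 1) q).le
  have hw1 := fun q => (wt_pos s q).le
  rw [lintegral_Ioi_eq_iSup fun r => ENNReal.ofReal (wt s (t - r) * p r ^ 2)]
  refine iSup_le fun n => ?_
  have hn : (0 : ℝ) ≤ n := Nat.cast_nonneg n
  have h8 : ENNReal.ofReal 8 = 8 := by simp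
  rw [← ofReal_intervalIntegral (by fun_prop) (fun r => mul_nonneg (hw1 _) (sq_nonneg _)) hn]
  refine (ENNReal.ofReal_le_ofReal (hardy_weight_interval hp hp' hn)).trans ?_
  refine ENNReal.ofReal_add_le.trans ?_
  rw [ENNReal.ofReal_mul (by norm_num), h8, ENNReal.ofReal_mul (by positivity),
    ofReal_intervalIntegral (by fun_prop) (fun r => mul_nonneg (hw1 _) (sq_nonneg _)) hn,
    ofReal_intervalIntegral (by fun_prop) (fun r => mul_nonneg (hw0 _) (sq_nonneg _)) hn]
  exact add_le_add (mul_le_mul_right (lintegral_mono_set Ioc_subset_Ioi_self) _)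
    (mul_le_mul_right (lintegral_mono_set Ioc_subset_Ioi_self) _)

end Hardy

/-! ### Recovering the full norm from the energy -/

/-- The energy density. -/
def energyDensity (s : ℝ) (φ : ℝ → E3 → ℝ) (t r : ℝ) (w : E3) : ℝ :=
  (1 / 2) * (outDensity s φ t r w + inDensity s φ t r w)

lemma energyDensity_nonneg (s : ℝ) (φ : ℝ → E3 → ℝ) (t r : ℝ) (w : E3) :
    0 ≤ energyDensity s φ t r w :=
  mul_nonneg (by norm_num) (add_nonneg (outDensity_nonneg s t r w) (inDensity_nonneg s t r w))

/-- For R ≥ 1 one has |t − R| ≤ (1 + t)R, so the boundary term is at most a constant times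
R·R^{2s−2}·R²φ² = (R^{s+1/2}φ)². This is where the exponent s + 1/2 comes from. -/
lemma tendsto_decay_ray {φ : ℝ → E3 → ℝ} {s t : ℝ} (hs : 1 ≤ s) (ht : 0 ≤ t)
    (hdec : Tendsto (fun x : E3 => ‖x‖ ^ (s + 1 / 2) * |φ t x|) (cocompact E3) (𝓝 0))
    {w : E3} (hw : ‖w‖ = 1) :
    Tendsto (fun R => |t - R| * wt (s - 1) (t - R) * (R * φ t (R • w)) ^ 2) atTop (𝓝 0) := by
  have hco : Tendsto (fun R : ℝ => R • w) atTop (cocompact E3) := by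
    rw [← Metric.cobounded_eq_cocompact, ← tendsto_norm_atTop_iff_cobounded]
    simpa [norm_smul, hw] using tendsto_abs_atTop_atTop
  have h1 := ((hdec.comp hco).pow 2).const_mul ((1 + t) * (1 + (1 + t) ^ 2) ^ (s - 1))
  rw [zero_pow two_ne_zero, mul_zero] at h1
  refine squeeze_zero' (Eventually.of_forall fun R => ?_) ?_ h1
  · have := wt_pos (s - 1) (t - R)
    positivity
  · filter_upwards [eventually_ge_atTop 1] with R hR
    have hR0 : 0 < R := by linarith
    have hn : ‖R • w‖ = R := by rw [norm_smul, hw, Real.norm_eq_abs, abs_of_pos hR0, mul_one]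
    have hab : |t - R| ≤ (1 + t) * R := by
      rw [abs_le]
      constructor <;> nlinarith
    have hw1 : wt (s - 1) (t - R) ≤ (1 + (1 + t) ^ 2) ^ (s - 1) * (R ^ 2) ^ (s - 1) := by
      rw [wt, ← Real.mul_rpow (by positivity) (by positivity)]
      refine Real.rpow_le_rpow (by positivity) ?_ (by linarith)
      have h2 : (t - R) ^ 2 ≤ ((1 + t) * R) ^ 2 := sq_le_sq' (by linarith [neg_abs_le (t - R)])
        ((le_abs_self _).trans hab)
      nlinarith
    have hpow : (R ^ (s + 1 / 2)) ^ 2 = R * (R ^ 2) ^ (s - 1) * R ^ 2 := by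
      rw [← Real.rpow_natCast, ← Real.rpow_mul hR0.le, ← Real.rpow_natCast, ← Real.rpow_mul hR0.le,
        ← Real.rpow_one_add' hR0.le, ← Real.rpow_add hR0]
      · congr 1
        push_cast
        ring
      · push_cast
        linarith
    simp only [Function.comp_apply, hn]
    rw [mul_pow, mul_pow, sq_abs, hpow]
    calc _ ≤ ((1 + t) * R) * ((1 + (1 + t) ^ 2) ^ (s - 1) * (R ^ 2) ^ (s - 1))
          * (R ^ 2 * φ t (R • w) ^ 2) := by
          have := (wt_pos (s - 1) (t - R)).le
          gcongr
      _ = _ := by ring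

/-- The first-order part of the norm is at most twice the energy. Since ∂_rψ = ½(Lψ − L̲ψ), the
energy also controls the right sides of the Hardy inequalities, which contribute 4 and 8 + 8s²·4;
the sum is 14 + 32s². -/
lemma lintegral_normDensity_le {φ : ℝ → E3 → ℝ} (hφ : ContDiff ℝ 2 (Function.uncurry φ)) {s t : ℝ}
    (hs : 1 ≤ s) (ht : 0 ≤ t)
    (hdec : Tendsto (fun x : E3 => ‖x‖ ^ (s + 1 / 2) * |φ t x|) (cocompact E3) (𝓝 0))
    {w : E3} (hw : ‖w‖ = 1) :
    ∫⁻ r in Ioi (0 : ℝ), ENNReal.ofReal (normDensity s φ t r w)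
      ≤ ENNReal.ofReal (14 + 32 * s ^ 2)
        * ∫⁻ r in Ioi (0 : ℝ), ENNReal.ofReal (energyDensity s φ t r w) := by
  have hφc := hφ.continuous
  have hxc := fun i => (contDiff_dx_one hφ i).continuous
  have hp : ∀ r : ℝ, HasDerivAt (fun r : ℝ => φ t (r • w)) (dirD φ t (r • w) w) r := by
    intro r
    have hX : HasDerivAt (fun r : ℝ => r • w) w r := by
      simpa using (hasDerivAt_id r).smul_const w
    refine (hasDerivAt_comp_curve (differentiable_self hφ _) (hasDerivAt_const r t) hX).congr_deriv ?_
    simp [dirD]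
  have hp' : Continuous fun r : ℝ => dirD φ t (r • w) w := by
    unfold dirD
    fun_prop
  have hrad : ∀ r ∈ Ioi (0 : ℝ), ENNReal.ofReal (wt s (t - r)
      * (φ t (r • w) + r * dirD φ t (r • w) w) ^ 2) ≤ ENNReal.ofReal (energyDensity s φ t r w) := by
    intro r hr
    refine ENNReal.ofReal_le_ofReal ?_
    have hr0 : 0 < r := hr
    have hle : wt s (t - r) ≤ wt s (t + r) := wt_le_wt (by linarith) (by nlinarith)
    have h1 : φ t (r • w) + r * dirD φ t (r • w) w = (1 / 2) * (polL φ t r w - polLbar φ t r w) := by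
      rw [polL, polLbar]
      ring
    have hA := polAng_nonneg (φ := φ) t r w
    have h2 := mul_nonneg (wt_pos s (t + r)).le (mul_nonneg (sq_nonneg r) hA)
    have h3 := mul_nonneg (wt_pos s (t - r)).le (mul_nonneg (sq_nonneg r) hA)
    have h4 := mul_nonneg (wt_pos s (t - r)).le (sq_nonneg (polL φ t r w + polLbar φ t r w))
    have h5 := mul_le_mul_of_nonneg_right hle (sq_nonneg (polL φ t r w))
    rw [h1, energyDensity, outDensity, inDensity]
    nlinarith
  set E := ∫⁻ r in Ioi (0 : ℝ), ENNReal.ofReal (energyDensity s φ t r w) with hE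
  have hradI : ∫⁻ r in Ioi (0 : ℝ), ENNReal.ofReal (wt s (t - r)
      * (φ t (r • w) + r * dirD φ t (r • w) w) ^ 2) ≤ E :=
    setLIntegral_mono' measurableSet_Ioi hrad
  have hH1 := (hardy_ray hs hp hp' (tendsto_decay_ray hs ht hdec hw)).trans
    (mul_le_mul_right hradI 4)
  have hH2 := (hardy_weight_ray (s := s) (t := t) hp hp').trans
    (add_le_add (mul_le_mul_right hradI 8) (mul_le_mul_right hH1 _))
  have hsplit : ∀ r, ENNReal.ofReal (normDensity s φ t r w)
      ≤ 2 * ENNReal.ofReal (energyDensity s φ t r w)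
        + (ENNReal.ofReal (wt s (t - r) * φ t (r • w) ^ 2)
          + ENNReal.ofReal (wt (s - 1) (t - r) * (r * φ t (r • w)) ^ 2)) := by
    intro r
    have hA := polAng_nonneg (φ := φ) t r w
    have h3 := mul_nonneg (wt_pos s (t - r)).le (mul_nonneg (sq_nonneg r) hA)
    have h20 : 2 * ENNReal.ofReal (energyDensity s φ t r w)
        = ENNReal.ofReal (2 * energyDensity s φ t r w) := by
      rw [ENNReal.ofReal_mul (by norm_num)]
      simp
    have hw0 := (wt_pos s (t - r)).le
    have hw1 := (wt_pos (s - 1) (t - r)).le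
    rw [h20, ← ENNReal.ofReal_add (by positivity) (by positivity),
      ← ENNReal.ofReal_add (mul_nonneg (by norm_num) (energyDensity_nonneg s φ t r w))
        (by positivity)]
    refine ENNReal.ofReal_le_ofReal ?_
    rw [normDensity, energyDensity, outDensity, inDensity]
    linarith
  have hm1 : Measurable fun r : ℝ => ENNReal.ofReal (wt s (t - r) * φ t (r • w) ^ 2) :=
    (Continuous.measurable (by fun_prop)).ennreal_ofReal
  have hm2 : Measurable fun r : ℝ => 2 * ENNReal.ofReal (energyDensity s φ t r w) := by
    have h1 := continuous_outDensity hφ s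
    have h2 := continuous_inDensity hφ s
    have : Continuous fun r : ℝ => energyDensity s φ t r w := by
      unfold energyDensity
      fun_prop
    exact this.measurable.ennreal_ofReal.const_mul 2
  calc ∫⁻ r in Ioi (0 : ℝ), ENNReal.ofReal (normDensity s φ t r w)
      ≤ ∫⁻ r in Ioi (0 : ℝ), (2 * ENNReal.ofReal (energyDensity s φ t r w)
        + (ENNReal.ofReal (wt s (t - r) * φ t (r • w) ^ 2)
          + ENNReal.ofReal (wt (s - 1) (t - r) * (r * φ t (r • w)) ^ 2))) :=
        lintegral_mono hsplit
    _ ≤ 2 * E + ((8 * E + ENNReal.ofReal (8 * s ^ 2) * (4 * E)) + 4 * E) := by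
        rw [lintegral_add_left hm2, lintegral_add_left hm1, lintegral_const_mul' _ _ (by simp)]
        exact add_le_add le_rfl (add_le_add hH2 hH1)
    _ = ENNReal.ofReal (14 + 32 * s ^ 2) * E := by
        have h14 : ENNReal.ofReal (14 + 32 * s ^ 2) = 14 + 4 * ENNReal.ofReal (8 * s ^ 2) := by
          rw [show 14 + 32 * s ^ 2 = 14 + 4 * (8 * s ^ 2) by ring,
            ENNReal.ofReal_add (by norm_num) (by positivity), ENNReal.ofReal_mul (by norm_num)]
          simp
        rw [h14]
        ring

/-! ### The energy estimate -/

lemma ofReal_sphere_interval_integral {F : ℝ → E3 → ℝ} (hF : Continuous (Function.uncurry F))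
    (h0 : ∀ r w, 0 ≤ F r w) {a b : ℝ} (hab : a ≤ b) :
    ENNReal.ofReal (∫ w : Metric.sphere (0 : E3) 1, (∫ r in a..b, F r w) ∂sphereMeasure)
      = ∫⁻ w : Metric.sphere (0 : E3) 1, (∫⁻ r in Ioc a b, ENNReal.ofReal (F r w))
        ∂sphereMeasure := by
  have hc : Continuous fun w : Metric.sphere (0 : E3) 1 => ∫ r in a..b, F r w := by
    refine intervalIntegral.continuous_parametric_intervalIntegral_of_continuous ?_
      continuous_const
    unfold Function.uncurry
    fun_prop
  rw [ofReal_integral_eq_lintegral_ofReal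
    (hc.integrable_of_hasCompactSupport (HasCompactSupport.of_compactSpace _))
    (Eventually.of_forall fun w => intervalIntegral.integral_nonneg hab fun r _ => h0 r w)]
  exact lintegral_congr fun w => ofReal_intervalIntegral (by fun_prop) (fun r => h0 r w) hab

/-- The Cauchy-Schwarz inequality in polar coordinates. -/
lemma lintegral_sqrt_mul_sqrt_le {P Q : ℝ → E3 → ℝ} (hP : Continuous (Function.uncurry P))
    (hQ : Continuous (Function.uncurry Q)) (hP0 : ∀ r w, 0 ≤ P r w) (hQ0 : ∀ r w, 0 ≤ Q r w)
    (S : Set ℝ) :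
    ∫⁻ w : Metric.sphere (0 : E3) 1, (∫⁻ r in S, ENNReal.ofReal (√(P r w) * √(Q r w)))
        ∂sphereMeasure
      ≤ (∫⁻ w : Metric.sphere (0 : E3) 1, (∫⁻ r in S, ENNReal.ofReal (P r w))
          ∂sphereMeasure) ^ (1 / 2 : ℝ)
        * (∫⁻ w : Metric.sphere (0 : E3) 1, (∫⁻ r in S, ENNReal.ofReal (Q r w))
          ∂sphereMeasure) ^ (1 / 2 : ℝ) := by
  have hm : ∀ {F : ℝ → E3 → ℝ}, Continuous (Function.uncurry F) → AEMeasurable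
      (fun p : Metric.sphere (0 : E3) 1 × ℝ => ENNReal.ofReal (F p.2 p.1))
      (sphereMeasure.prod (volume.restrict S)) := fun hF =>
    (Continuous.measurable (by fun_prop)).ennreal_ofReal.aemeasurable
  have hsq : ∀ {y : ℝ}, 0 ≤ y → ENNReal.ofReal (√y) ^ (2 : ℝ) = ENNReal.ofReal y := by
    intro y hy
    rw [ENNReal.rpow_two, ← ENNReal.ofReal_pow (Real.sqrt_nonneg _), Real.sq_sqrt hy]
  have hPs : Continuous (Function.uncurry fun r w => √(P r w)) := by
    unfold Function.uncurry
    fun_prop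
  have hQs : Continuous (Function.uncurry fun r w => √(Q r w)) := by
    unfold Function.uncurry
    fun_prop
  have hPQ : Continuous (Function.uncurry fun r w => √(P r w) * √(Q r w)) := by
    unfold Function.uncurry
    fun_prop
  have h := ENNReal.lintegral_mul_le_Lp_mul_Lq (sphereMeasure.prod (volume.restrict S))
    Real.HolderConjugate.two_two (hm hPs) (hm hQs)
  simp only [Pi.mul_apply, ← ENNReal.ofReal_mul (Real.sqrt_nonneg _), hsq (hP0 _ _),
    hsq (hQ0 _ _)] at h
  rwa [lintegral_prod _ (hm hPQ), lintegral_prod _ (hm hP), lintegral_prod _ (hm hQ)] at h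

section Energy

variable {φ : ℝ → E3 → ℝ}

/-- Since g ≤ f, (fLψ + gL̲ψ)² ≤ 2f(f(Lψ)² + g(L̲ψ)²). The factor f is the weight that the source
norm puts on □φ. -/
lemma sq_multiplier_le {s t r : ℝ} (hs : 0 ≤ s) (ht : 0 ≤ t) (hr : 0 ≤ r) (w : E3) :
    multiplier s φ t r w ^ 2 ≤ wt s (t + r) * (4 * energyDensity s φ t r w) := by
  have hle : wt s (t - r) ≤ wt s (t + r) := wt_le_wt hs (by nlinarith)
  have hA := polAng_nonneg (φ := φ) t r w
  have hf := (wt_pos s (t + r)).le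
  have hg := (wt_pos s (t - r)).le
  set f := wt s (t + r)
  set g := wt s (t - r)
  set L := polL φ t r w
  set M := polLbar φ t r w
  have h1 : (f * L + g * M) ^ 2 ≤ 2 * (f * (f * L ^ 2)) + 2 * (g * (g * M ^ 2)) := by
    nlinarith [sq_nonneg (f * L - g * M)]
  have h2 : g * (g * M ^ 2) ≤ f * (g * M ^ 2) := mul_le_mul_of_nonneg_right hle (by positivity)
  have h3 : 0 ≤ f * (f * (r ^ 2 * polAng φ t r w) + g * (r ^ 2 * polAng φ t r w)) := by positivity
  rw [multiplier, energyDensity, outDensity, inDensity]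
  linarith

variable (hφ : ContDiff ℝ 2 (Function.uncurry φ))
include hφ

lemma continuous_energyDensity (s : ℝ) :
    Continuous fun p : ℝ × ℝ × E3 => energyDensity s φ p.1 p.2.1 p.2.2 := by
  have h1 := continuous_outDensity hφ s
  have h2 := continuous_inDensity hφ s
  unfold energyDensity
  fun_prop

lemma ofReal_coneEnergy (s : ℝ) {c t : ℝ} (hct : c ≤ t) :
    ENNReal.ofReal (coneEnergy s φ c t) = ∫⁻ w : Metric.sphere (0 : E3) 1,
      (∫⁻ r in Ioc 0 (t - c), ENNReal.ofReal (energyDensity s φ t r w)) ∂sphereMeasure := by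
  have h := continuous_energyDensity hφ s
  refine ofReal_sphere_interval_integral (F := fun r w => energyDensity s φ t r w) ?_
    (fun r w => energyDensity_nonneg s φ t r w) (by linarith)
  unfold Function.uncurry
  fun_prop

lemma ofReal_coneFlux (s : ℝ) {c a b : ℝ} (hab : a ≤ b) :
    ENNReal.ofReal (coneFlux s φ c a b) = ∫⁻ w : Metric.sphere (0 : E3) 1,
      (∫⁻ t in Ioc a b, ENNReal.ofReal (inDensity s φ t (t - c) w)) ∂sphereMeasure := by
  have h := continuous_inDensity hφ s
  refine ofReal_sphere_interval_integral (F := fun t w => inDensity s φ t (t - c) w) ?_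
    (fun t w => inDensity_nonneg s t (t - c) w) hab
  unfold Function.uncurry
  fun_prop

omit hφ in
lemma coneEnergy_nonneg (s : ℝ) {c t : ℝ} (hct : c ≤ t) : 0 ≤ coneEnergy s φ c t :=
  integral_nonneg fun w => intervalIntegral.integral_nonneg (by linarith)
    fun r _ => energyDensity_nonneg s φ t r w

omit hφ in
lemma coneFlux_nonneg (s c : ℝ) {a b : ℝ} (hab : a ≤ b) : 0 ≤ coneFlux s φ c a b :=
  integral_nonneg fun w => intervalIntegral.integral_nonneg hab
    fun t _ => inDensity_nonneg s t (t - c) w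

omit hφ in
lemma coneSource_nonneg (s : ℝ) {c t : ℝ} (hct : c ≤ t) : 0 ≤ coneSource s φ c t :=
  integral_nonneg fun _ => intervalIntegral.integral_nonneg (by linarith) fun _ _ => abs_nonneg _

lemma continuous_coneSource (s c : ℝ) : Continuous fun t => coneSource s φ c t := by
  have hbox := continuous_box hφ
  have hmul := continuous_multiplier hφ s
  exact continuous_cone_integral (F := fun p => |p.2.1 * box φ p.1 (p.2.1 • p.2.2)
    * multiplier s φ p.1 p.2.1 p.2.2|) (by fun_prop) c

/-- Cauchy-Schwarz, with the weight of `sq_multiplier_le` moved onto □φ; the 2 is the root of the 4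
there. -/
lemma ofReal_coneSource_le {s c t : ℝ} (hs : 0 ≤ s) (ht : 0 ≤ t) (hct : c ≤ t) :
    ENNReal.ofReal (coneSource s φ c t)
      ≤ eLpNorm (fun x : E3 => jb (t + ‖x‖) ^ s * box φ t x) 2 volume
        * ENNReal.ofReal (2 * √(coneEnergy s φ c t)) := by
  have hbox := continuous_box hφ
  have hmul := continuous_multiplier hφ s
  have hen := continuous_energyDensity hφ s
  have h4 : ENNReal.ofReal (2 * √(coneEnergy s φ c t))
      = (∫⁻ w : Metric.sphere (0 : E3) 1, (∫⁻ r in Ioc 0 (t - c),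
        ENNReal.ofReal (4 * energyDensity s φ t r w)) ∂sphereMeasure) ^ (1 / 2 : ℝ) := by
    simp only [ENNReal.ofReal_mul (by norm_num : (0 : ℝ) ≤ 4)]
    simp only [lintegral_const_mul' _ _ ENNReal.ofReal_ne_top]
    rw [← ofReal_coneEnergy hφ s hct, ← ENNReal.ofReal_mul (by norm_num),
      ENNReal.ofReal_rpow_of_nonneg (mul_nonneg (by norm_num) (coneEnergy_nonneg s hct))
        (by norm_num), ← Real.sqrt_eq_rpow, Real.sqrt_mul (by norm_num),
      show √(4 : ℝ) = 2 by rw [show (4 : ℝ) = 2 ^ 2 by norm_num]; simp]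
  rw [h4, eLpNorm_source_eq hφ, coneSource, ofReal_sphere_interval_integral
    (F := fun r w => |r * box φ t (r • w) * multiplier s φ t r w|)
    (by unfold Function.uncurry; fun_prop) (fun r w => abs_nonneg _) (by linarith)]
  have hP : Continuous (Function.uncurry fun (r : ℝ) (w : E3) =>
      wt s (t + r) * (r * box φ t (r • w)) ^ 2) := by
    unfold Function.uncurry
    fun_prop
  have hQ : Continuous (Function.uncurry fun (r : ℝ) (w : E3) =>
      4 * energyDensity s φ t r w) := by
    unfold Function.uncurry
    fun_prop
  refine le_trans ?_ ((lintegral_sqrt_mul_sqrt_le hP hQ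
    (fun r w => mul_nonneg (wt_pos _ _).le (sq_nonneg _))
    (fun r w => mul_nonneg (by norm_num) (energyDensity_nonneg s φ t r w)) (Ioc 0 (t - c))).trans ?_)
  · refine lintegral_mono fun w => setLIntegral_mono' measurableSet_Ioc fun r hr => ?_
    refine ENNReal.ofReal_le_ofReal ?_
    rw [← Real.sqrt_mul (mul_nonneg (wt_pos _ _).le (sq_nonneg _))]
    refine Real.abs_le_sqrt ?_
    have := mul_le_mul_of_nonneg_left (sq_multiplier_le (φ := φ) hs ht hr.1.le (w : E3))
      (sq_nonneg (r * box φ t (r • (w : E3))))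
    rw [mul_pow]
    linarith
  · gcongr
    exact Ioc_subset_Ioi_self

/-- The energy estimate inside an outgoing cone. -/
lemma cone_energy_estimate {s : ℝ} (hs : 1 ≤ s) {a b c : ℝ} (ha : 0 ≤ a) (hca : c ≤ a)
    (hab : a ≤ b) {N P : ℝ} (hN0 : 0 ≤ N) (hP0 : 0 ≤ P)
    (hN : ∫⁻ t in Icc a b, eLpNorm (fun x : E3 => jb (t + ‖x‖) ^ s * box φ t x) 2 volume
      ≤ ENNReal.ofReal N)
    (hP : coneEnergy s φ c b ≤ P ^ 2) :
    coneEnergy s φ c a + coneFlux s φ c a b ≤ (P + 2 * N) ^ 2 := by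
  have hcE := continuous_coneEnergy hφ s c
  -- At a time of maximal cone energy m², the energy inequality reads m² ≤ P² + 2Nm. This forces m ≤
  -- P + 2N, and inserting that bound in the inequality from a gives the claim.
  obtain ⟨t₀, ht₀, hmax⟩ := isCompact_Icc.exists_isMaxOn (nonempty_Icc.2 hab) hcE.continuousOn
  set m := √(coneEnergy s φ c t₀) with hm
  have hm0 : 0 ≤ m := Real.sqrt_nonneg _
  have hm2 : m ^ 2 = coneEnergy s φ c t₀ := Real.sq_sqrt (coneEnergy_nonneg s (hca.trans ht₀.1))
  have hsrc : ∀ a' ∈ Icc a b, ∫ t in a'..b, coneSource s φ c t ≤ N * (2 * m) := by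
    intro a' ha'
    have hint : ENNReal.ofReal (∫ t in a'..b, coneSource s φ c t)
        = ∫⁻ t in Ioc a' b, ENNReal.ofReal (coneSource s φ c t) := by
      rw [intervalIntegral.integral_of_le ha'.2, ofReal_integral_eq_lintegral_ofReal]
      · exact ((continuous_coneSource hφ s c).integrableOn_Icc).mono_set Ioc_subset_Icc_self
      · exact (ae_restrict_mem measurableSet_Ioc).mono fun t ht =>
          coneSource_nonneg s (hca.trans (ha'.1.trans ht.1.le))
    have hle : ∫⁻ t in Ioc a' b, ENNReal.ofReal (coneSource s φ c t)
        ≤ ENNReal.ofReal N * ENNReal.ofReal (2 * m) := by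
      calc ∫⁻ t in Ioc a' b, ENNReal.ofReal (coneSource s φ c t)
          ≤ ∫⁻ t in Icc a b, eLpNorm (fun x : E3 => jb (t + ‖x‖) ^ s * box φ t x) 2 volume
            * ENNReal.ofReal (2 * m) := by
            refine (lintegral_mono_set (t := Icc a b)
              (fun t ht => ⟨ha'.1.trans ht.1.le, ht.2⟩)).trans ?_
            refine setLIntegral_mono' measurableSet_Icc fun t ht => ?_
            refine (ofReal_coneSource_le hφ (by linarith) (ha.trans ht.1)
              (hca.trans ht.1)).trans ?_
            gcongr
            exact Real.sqrt_le_sqrt (hmax ht)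
        _ ≤ _ := by
            rw [lintegral_mul_const' _ _ ENNReal.ofReal_ne_top]
            gcongr
    rw [← hint, ← ENNReal.ofReal_mul hN0] at hle
    exact (ENNReal.ofReal_le_ofReal_iff (by positivity)).1 hle
  have h1 := coneEnergy_le hφ hs (ha.trans ht₀.1) (hca.trans ht₀.1) ht₀.2
  have h2 := coneEnergy_le hφ hs ha hca hab
  have h3 := hsrc t₀ ht₀
  have h4 := hsrc a (left_mem_Icc.2 hab)
  have h5 := coneFlux_nonneg (φ := φ) s c ht₀.2
  have hmle : m ≤ P + 2 * N := by
    by_contra! hlt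
    nlinarith
  nlinarith

/-- A finite bound `P` for `normPlus` bounds all cone energies. -/
lemma coneEnergy_le_of_normPlus_le {s t c P : ℝ} (hct : c ≤ t) (hP0 : 0 ≤ P)
    (hP : normPlus s φ t ≤ ENNReal.ofReal P) (hs : 0 ≤ s) (ht : 0 ≤ t) :
    coneEnergy s φ c t ≤ P ^ 2 := by
  rw [← ENNReal.ofReal_le_ofReal_iff (by positivity), ofReal_coneEnergy hφ s hct]
  rw [normPlus_eq hφ] at hP
  have h2 : ENNReal.ofReal (P ^ 2) = ENNReal.ofReal P ^ (2 : ℝ) := by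
    rw [ENNReal.rpow_two, ENNReal.ofReal_pow hP0]
  have hP2 := ENNReal.rpow_le_rpow hP (by norm_num : (0 : ℝ) ≤ 2)
  rw [← ENNReal.rpow_mul, one_div, inv_mul_cancel₀ two_ne_zero, ENNReal.rpow_one, ← h2] at hP2
  refine le_trans (lintegral_mono fun w => ?_) hP2
  refine (lintegral_mono_set Ioc_subset_Ioi_self).trans
    (setLIntegral_mono' measurableSet_Ioi fun r hr => ENNReal.ofReal_le_ofReal ?_)
  have hr0 : 0 < r := hr
  have hle : wt s (t - r) ≤ wt s (t + r) := wt_le_wt hs (by nlinarith)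
  have hA := polAng_nonneg (φ := φ) t r w
  have hw0 := (wt_pos s (t - r)).le
  have hw1 := (wt_pos (s - 1) (t - r)).le
  have hw2 := (wt_pos s (t + r)).le
  have h3 := mul_le_mul_of_nonneg_right hle (by positivity : 0 ≤ r ^ 2 * polAng φ t r w)
  have h4 : 0 ≤ wt s (t + r) * polL φ t r w ^ 2 := by positivity
  have h5 : 0 ≤ wt s (t - r) * polLbar φ t r w ^ 2 := by positivity
  have h6 : 0 ≤ wt s (t - r) * φ t (r • (w : E3)) ^ 2 := by positivity
  have h7 : 0 ≤ wt (s - 1) (t - r) * (r * φ t (r • (w : E3))) ^ 2 := by positivity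
  rw [normDensity, energyDensity, outDensity, inDensity]
  linarith

/-- The cone may have its vertex after t₁, and then the flux starts only there; the bound is
therefore applied from a = max(t₁, t₂ − R), the first time at which the cone energy inequality is
available. -/
lemma flux_le {s : ℝ} {R t₁ t₂ B : ℝ}
    (hB : ∀ a ∈ Icc t₁ t₂, t₂ - R ≤ a → coneFlux s φ (t₂ - R) a t₂ ≤ B) :
    flux s φ R t₁ t₂ ≤ ENNReal.ofReal B := by
  have hin := continuous_inDensity hφ s
  set c := t₂ - R with hc
  have hRc : ∀ t : ℝ, R - (t₂ - t) = t - c := fun t => by rw [hc]; ring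
  rw [flux]
  simp only [hRc]
  have hm : MeasurableSet {t : ℝ | t ∈ Icc t₁ t₂ ∧ 0 < t - c} :=
    measurableSet_Icc.inter (measurableSet_lt (f := fun _ : ℝ => (0 : ℝ)) (g := fun t => t - c)
      measurable_const (by fun_prop))
  have heq : ∫⁻ t in {t : ℝ | t ∈ Icc t₁ t₂ ∧ 0 < t - c}, (∫⁻ w : Metric.sphere (0 : E3) 1,
      ENNReal.ofReal (fluxDensity s φ t ((t - c) • (w : E3))) ∂sphereMeasure)
      = ∫⁻ t in {t : ℝ | t ∈ Icc t₁ t₂ ∧ 0 < t - c}, (∫⁻ w : Metric.sphere (0 : E3) 1,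
      ENNReal.ofReal (inDensity s φ t (t - c) w) ∂sphereMeasure) := by
    refine setLIntegral_congr_fun hm fun t ht => lintegral_congr fun w => ?_
    rw [fluxDensity_eq (differentiable_self hφ) s t ht.2 (by simp)]
  rw [heq]
  rcases lt_or_ge t₂ (max t₁ c) with hlt | hle
  · have hempty : {t : ℝ | t ∈ Icc t₁ t₂ ∧ 0 < t - c} = ∅ := by
      ext t
      simp only [mem_ofPred_eq, mem_Icc, mem_empty_iff_false, iff_false]
      rintro ⟨⟨h1, h2⟩, h3⟩
      exact absurd (max_le (h1.trans h2) (by linarith)) (not_le.2 hlt)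
    rw [hempty]
    simp
  · have hsub : {t : ℝ | t ∈ Icc t₁ t₂ ∧ 0 < t - c} ⊆ Icc (max t₁ c) t₂ := by
      rintro t ⟨⟨h1, h2⟩, h3⟩
      exact ⟨max_le h1 (by linarith), h2⟩
    refine (lintegral_mono_set hsub).trans ?_
    rw [setLIntegral_congr Ioc_ae_eq_Icc.symm, lintegral_lintegral_swap, ← ofReal_coneFlux hφ s hle]
    · exact ENNReal.ofReal_le_ofReal (hB _ ⟨le_max_left _ _, hle⟩ (le_max_right _ _))
    · refine (Measurable.ennreal_ofReal (Continuous.measurable ?_)).aemeasurable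
      fun_prop

/-- The total energy is bounded by the energies inside cones. -/
lemma lintegral_energyDensity_le {s t B : ℝ} (hB : ∀ c ≤ t, coneEnergy s φ c t ≤ B) :
    ∫⁻ w : Metric.sphere (0 : E3) 1, (∫⁻ r in Ioi (0 : ℝ),
      ENNReal.ofReal (energyDensity s φ t r w)) ∂sphereMeasure ≤ ENNReal.ofReal B := by
  have hen := continuous_energyDensity hφ s
  simp only [lintegral_Ioi_eq_iSup]
  rw [lintegral_iSup]
  · refine iSup_le fun n => ?_
    -- The cone with c = t − n cuts out the ball of radius n at time t; monotone convergence in n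
    -- gives all of space.
    have h := ofReal_coneEnergy hφ s (c := t - n) (t := t) (by simp)
    rw [sub_sub_cancel] at h
    rw [← h]
    exact ENNReal.ofReal_le_ofReal (hB _ (by simp))
  · intro n
    refine Measurable.lintegral_prod_right' (f := fun p : Metric.sphere (0 : E3) 1 × ℝ =>
      ENNReal.ofReal (energyDensity s φ t p.2 p.1)) ?_
    exact (Continuous.measurable (by fun_prop)).ennreal_ofReal
  · intro m n hmn w
    exact lintegral_mono_set (Ioc_subset_Ioc_right (by exact_mod_cast hmn))

/-- The fractional Morawetz estimate for globally `C²` functions. -/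
lemma morawetz_estimate {s t₁ t₂ : ℝ} (hs : 1 ≤ s) (h1 : 0 ≤ t₁) (h12 : t₁ ≤ t₂)
    (hdec : Tendsto (fun x : E3 => ‖x‖ ^ (s + 1 / 2) * |φ t₁ x|) (cocompact E3) (𝓝 0)) :
    normPlus s φ t₁ + (⨆ R : ℝ, flux s φ R t₁ t₂ ^ (1 / 2 : ℝ))
      ≤ (ENNReal.ofReal (14 + 32 * s ^ 2) ^ (1 / 2 : ℝ) + 1) * 2
        * (normPlus s φ t₂ + sourceNorm s φ t₁ t₂) := by
  -- An infinite right side makes the claim trivial, the constant being nonzero; otherwise both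
  -- norms are real numbers P and N.
  by_cases htop : normPlus s φ t₂ = ⊤ ∨ sourceNorm s φ t₁ t₂ = ⊤
  · have : normPlus s φ t₂ + sourceNorm s φ t₁ t₂ = ⊤ := by simpa using htop
    rw [this, ENNReal.mul_top (by simp)]
    exact le_top
  push Not at htop
  obtain ⟨hPtop, hNtop⟩ := htop
  set P := (normPlus s φ t₂).toReal
  set N := (sourceNorm s φ t₁ t₂).toReal
  have hP : normPlus s φ t₂ = ENNReal.ofReal P := (ENNReal.ofReal_toReal hPtop).symm
  have hN : sourceNorm s φ t₁ t₂ = ENNReal.ofReal N := (ENNReal.ofReal_toReal hNtop).symm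
  have hP0 : 0 ≤ P := ENNReal.toReal_nonneg
  have hN0 : 0 ≤ N := ENNReal.toReal_nonneg
  have key : ∀ a ∈ Icc t₁ t₂, ∀ c ≤ a,
      coneEnergy s φ c a + coneFlux s φ c a t₂ ≤ (P + 2 * N) ^ 2 := by
    intro a ha c hca
    refine cone_energy_estimate hφ hs (h1.trans ha.1) hca ha.2 hN0 hP0 ?_
      (coneEnergy_le_of_normPlus_le hφ (hca.trans ha.2) hP0 hP.le (by linarith) (h1.trans h12))
    rw [← hN, sourceNorm]
    exact lintegral_mono_set (Icc_subset_Icc_left ha.1)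
  have hroot : ENNReal.ofReal ((P + 2 * N) ^ 2) ^ (1 / 2 : ℝ) = ENNReal.ofReal (P + 2 * N) := by
    rw [ENNReal.ofReal_rpow_of_nonneg (by positivity) (by norm_num), ← Real.sqrt_eq_rpow,
      Real.sqrt_sq (by positivity)]
  have hflux : (⨆ R : ℝ, flux s φ R t₁ t₂ ^ (1 / 2 : ℝ)) ≤ ENNReal.ofReal (P + 2 * N) := by
    refine iSup_le fun R => ?_
    rw [← hroot]
    refine ENNReal.rpow_le_rpow (flux_le hφ fun a ha hca => ?_) (by norm_num)
    have := key a ha _ hca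
    have := coneEnergy_nonneg (φ := φ) s hca
    linarith
  have henergy := lintegral_energyDensity_le hφ (s := s) (t := t₁) (B := (P + 2 * N) ^ 2)
    fun c hc => by
      have := key t₁ (left_mem_Icc.2 h12) c hc
      have := coneFlux_nonneg (φ := φ) s c h12
      linarith
  have hnorm : normPlus s φ t₁
      ≤ ENNReal.ofReal (14 + 32 * s ^ 2) ^ (1 / 2 : ℝ) * ENNReal.ofReal (P + 2 * N) := by
    rw [normPlus_eq hφ, ← hroot, ← ENNReal.mul_rpow_of_nonneg _ _ (by norm_num)]
    refine ENNReal.rpow_le_rpow ?_ (by norm_num)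
    refine le_trans (lintegral_mono fun w =>
      lintegral_normDensity_le hφ hs h1 hdec (w := (w : E3)) (by simp)) ?_
    rw [lintegral_const_mul' _ _ ENNReal.ofReal_ne_top]
    gcongr
  have hPN : ENNReal.ofReal (P + 2 * N) ≤ 2 * (normPlus s φ t₂ + sourceNorm s φ t₁ t₂) := by
    rw [hP, hN, ← ENNReal.ofReal_add hP0 hN0, ← ENNReal.ofReal_ofNat 2,
      ← ENNReal.ofReal_mul (by norm_num)]
    exact ENNReal.ofReal_le_ofReal (by linarith)
  calc _ ≤ (ENNReal.ofReal (14 + 32 * s ^ 2) ^ (1 / 2 : ℝ) + 1) * ENNReal.ofReal (P + 2 * N) := by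
        rw [add_mul, one_mul]
        exact add_le_add hnorm hflux
    _ ≤ _ := by
        rw [mul_assoc]
        gcongr

end Energy

end Morawetz

end

theorem theorem1p3 (s : ℝ) (hs : 1 ≤ s) :
    ∃ C : ℝ≥0, ∀ (t₁ t₂ : ℝ), 0 ≤ t₁ → t₁ ≤ t₂ → ∀ φ : ℝ → Morawetz.E3 → ℝ,
      (∀ t ∈ Icc t₁ t₂, ∀ x : Morawetz.E3, ContDiffAt ℝ 2 (Function.uncurry φ) (t, x)) →
      (Tendsto (fun x : Morawetz.E3 => ‖x‖ ^ (s + 1 / 2) * |φ t₁ x|)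
          (cocompact Morawetz.E3) (𝓝 0) →
        Morawetz.normPlus s φ t₁ + (⨆ R : ℝ, Morawetz.flux s φ R t₁ t₂ ^ (1 / 2 : ℝ))
          ≤ C * (Morawetz.normPlus s φ t₂ + Morawetz.sourceNorm s φ t₁ t₂)) ∧
      Morawetz.normZ s φ t₁ ≤ C * Morawetz.normPlus s φ t₁ := by
  -- `K` serves part (i) and 36 serves part (ii); their sum serves both.
  set K : ℝ≥0∞ := (ENNReal.ofReal (14 + 32 * s ^ 2) ^ (1 / 2 : ℝ) + 1) * 2 with hK
  have hKtop : K + 36 ≠ ⊤ := by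
    refine ENNReal.add_ne_top.2 ⟨ENNReal.mul_ne_top (ENNReal.add_ne_top.2 ⟨?_, by simp⟩)
      (by simp), by simp⟩
    exact ENNReal.rpow_ne_top_of_nonneg (by norm_num) ENNReal.ofReal_ne_top
  refine ⟨(K + 36).toNNReal, fun t₁ t₂ h1 h12 φ hφ => ?_⟩
  -- Every quantity in the statement depends only on the germ of φ along the slab, so φ may be
  -- replaced by a globally C² function with the same germs.
  obtain ⟨ψ, hψ, hψφ⟩ := Morawetz.exists_contDiff_extension hφ
  have hleft := left_mem_Icc.2 h12
  rw [ENNReal.coe_toNNReal hKtop, Morawetz.normPlus_congr s (hψφ t₁ hleft),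
    Morawetz.normPlus_congr s (hψφ t₂ (right_mem_Icc.2 h12)),
    Morawetz.normZ_congr s (hψφ t₁ hleft), Morawetz.sourceNorm_congr s hψφ]
  simp only [Morawetz.flux_congr s _ hψφ]
  have h0 : ∀ x, φ t₁ x = ψ t₁ x := fun x => (hψφ t₁ hleft x).self_of_nhds
  simp only [h0]
  refine ⟨fun hdec => ?_, ?_⟩
  · exact (Morawetz.morawetz_estimate hψ hs h1 h12 hdec).trans (by gcongr; exact le_self_add)
  · refine (Morawetz.normZ_le (Morawetz.differentiable_self hψ) hs h1).trans ?_
    gcongr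
    exact le_add_self
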